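/- Let $d\ge 1$, let $M_d$ be the algebra of $d\times d$ complex matrices, let $(\Omega,\mathcal F,\mu)$ be a probability space, let $\theta:\Omega\to\Omega$ be an invertible (with measurable inverse) ergodic $\mu$-preserving transformation, and let $\phi:\omega\mapsto\phi_\omega$ be a measurable map from $\Omega$ to the quantum channels (completely positive trace-preserving linear maps) on $M_d$. These data define an ergodic quantum process $\Phi=(\phi_{\theta^n(\omega)})_n$. Random matrices $\Omega\to M_d$ are measurable and identified when almost surely equal; a random projection is a random matrix $p$ such that $p_\omega=p_\omega^2=p_\omega^*\neq 0$ almost surely. Assume that $\Phi$ is irreducible: the only random projection $p$ with $\phi_{\theta(\omega)}(p_\omega M_d\,p_\omega)\subseteq p_{\theta(\omega)}M_d\,p_{\theta(\omega)}$ for a.e. $\omega$ is $p=\mathbb I$. Let $\Lambda_\Phi$ be the set of peripheral eigenvalues of $\Phi$, i.e. of $\alpha\in\mathbb C$ with $|\alpha|=1$ for which there is a nonzero random matrix $x$ with $$\phi_{\theta(\omega)}(x_\omega)=\alpha\,x_{\theta(\omega)}\quad\text{for a.e. }\omega, \tag{$*$}$$ and let $\Lambda_\theta$ be the set of eigenvalues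 of $\theta$, i.e. of $\beta\in\mathbb C$ for which there is a measurable $f:\Omega\to\mathbb C$, not almost surely zero, with $f\circ\theta=\beta f$ almost surely. For $\alpha\in\Lambda_\Phi$ let $N_\alpha=\inf\{n\ge 1: \alpha^n\in\Lambda_\theta\}$, with $\inf\emptyset=\infty$. Then $\Lambda_\theta\subseteq\Lambda_\Phi$ are groups under multiplication, and the quotient group $\Gamma_\Phi=\Lambda_\Phi/\Lambda_\theta$ is finite with $|\Gamma_\Phi|\le d^2$. Moreover, every $\alpha\in\Lambda_\Phi$ is simple, i.e. the vector space of random matrices $x$ satisfying $(*)$ is one-dimensional, and $N_\alpha\le d$. -/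

import Mathlib

open MeasureTheory

section Channels

open scoped Matrix.Norms.L2Operator MatrixOrder CStarAlgebra

/-- A linear map `ψ` on the C⋆-algebra `M_d` of `d × d` complex matrices is a quantum channel if it
is completely positive (that is, the underlying map of a bundled completely positive map) and trace
preserving. -/
structure IsQuantumChannel {d : ℕ}
    (ψ : Matrix (Fin d) (Fin d) ℂ →ₗ[ℂ] Matrix (Fin d) (Fin d) ℂ) : Prop where
  completelyPositive : ∃ Ψ : Matrix (Fin d) (Fin d) ℂ →CP Matrix (Fin d) (Fin d) ℂ,
    ∀ a, Ψ a = ψ a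
  trace_map : ∀ a, (ψ a).trace = a.trace

end Channels

/-- Random `d × d` matrices over `(Ω, μ)`: measurable maps from `Ω` to `M_d`, modulo almost
everywhere equality. -/
abbrev RandomMatrix {Ω : Type*} [MeasurableSpace Ω] (μ : Measure Ω) (d : ℕ) : Type _ :=
  Ω →ₘ[μ] Matrix (Fin d) (Fin d) ℂ

/-- The data `(θ, φ)` defining an ergodic quantum process `φ_n = φ ∘ θ^n` over `(Ω, μ)`: an
invertible (bi-measurable) ergodic measure-preserving transformation `θ` and a random quantum
channel `φ`. Measurability of `φ`, as a map into the finite-dimensional space of linear maps on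
`M_d`, is measurability of all its matrix coefficients. -/
structure ErgodicQuantumProcess {Ω : Type*} [MeasurableSpace Ω] (μ : Measure Ω) (d : ℕ) where
  θ : Ω ≃ᵐ Ω
  ergodic : Ergodic θ μ
  φ : Ω → Matrix (Fin d) (Fin d) ℂ →ₗ[ℂ] Matrix (Fin d) (Fin d) ℂ
  measurable_φ : ∀ (a : Matrix (Fin d) (Fin d) ℂ) (i j : Fin d), Measurable fun ω => φ ω a i j
  isQuantumChannel_φ : ∀ ω, IsQuantumChannel (φ ω)

namespace ErgodicQuantumProcess

variable {Ω : Type*} [MeasurableSpace Ω] {μ : Measure Ω} {d : ℕ}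

/-- A random matrix is a random projection if almost surely it is a nonzero orthogonal
projection. -/
def IsRandomProjection (p : RandomMatrix μ d) : Prop :=
  ∀ᵐ ω ∂μ, p ω ≠ 0 ∧ IsStarProjection (p ω)

/-- `p` reduces the process if `φ_{θ(ω)}(p_ω M_d p_ω) ⊆ p_{θ(ω)} M_d p_{θ(ω)}` for a.e. `ω`. -/
def Reduces (Φ : ErgodicQuantumProcess μ d) (p : RandomMatrix μ d) : Prop :=
  ∀ᵐ ω ∂μ, ∀ a : Matrix (Fin d) (Fin d) ℂ, ∃ b : Matrix (Fin d) (Fin d) ℂ,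
    Φ.φ (Φ.θ ω) (p ω * a * p ω) = p (Φ.θ ω) * b * p (Φ.θ ω)

/-- The process is irreducible if the only random projection reducing it is the identity. -/
def IsIrreducible (Φ : ErgodicQuantumProcess μ d) : Prop :=
  ∀ p : RandomMatrix μ d, IsRandomProjection p → Φ.Reduces p → ∀ᵐ ω ∂μ, p ω = 1

/-- The vector space of random matrices `x` with `φ_{θ(ω)}(x_ω) = α x_{θ(ω)}` for a.e. `ω`. -/
def eigenspace (Φ : ErgodicQuantumProcess μ d) (α : ℂ) : Submodule ℂ (RandomMatrix μ d) where
  carrier := {x | ∀ᵐ ω ∂μ, Φ.φ (Φ.θ ω) (x ω) = α • x (Φ.θ ω)}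
  zero_mem' := by
    have h := AEEqFun.coeFn_zero (α := Ω) (μ := μ) (β := Matrix (Fin d) (Fin d) ℂ)
    filter_upwards [h, Φ.ergodic.quasiMeasurePreserving.ae h] with ω h₁ h₂
    rw [h₁, h₂]
    simp
  add_mem' := by
    intro x y hx hy
    have h := AEEqFun.coeFn_add x y
    filter_upwards [hx, hy, h, Φ.ergodic.quasiMeasurePreserving.ae h] with ω hx hy h₁ h₂
    rw [h₁, h₂, Pi.add_apply, Pi.add_apply, map_add, hx, hy, smul_add]
  smul_mem' := by
    intro c x hx
    have h := AEEqFun.coeFn_smul c x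
    filter_upwards [hx, h, Φ.ergodic.quasiMeasurePreserving.ae h] with ω hx h₁ h₂
    rw [h₁, h₂, Pi.smul_apply, Pi.smul_apply, map_smul, hx, smul_comm]

/-- `Λ_Φ`, the peripheral eigenvalues of the process: the `α` with `|α| = 1` that have a nonzero
eigenmatrix. -/
def peripheralEigenvalues (Φ : ErgodicQuantumProcess μ d) : Set ℂ :=
  {α | ‖α‖ = 1 ∧ ∃ x ∈ Φ.eigenspace α, x ≠ 0}

/-- `Λ_θ`, the eigenvalues of `θ`: the `β` for which there is a measurable `f : Ω → ℂ`, not almost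
surely zero, with `f ∘ θ = β f` almost surely. -/
def baseEigenvalues (Φ : ErgodicQuantumProcess μ d) : Set ℂ :=
  {β | ∃ f : Ω →ₘ[μ] ℂ, f ≠ 0 ∧ ∀ᵐ ω ∂μ, f (Φ.θ ω) = β * f ω}

/-- `N_α`, the least `n ≥ 1` with `α ^ n ∈ Λ_θ` (infinity if there is none). -/
noncomputable def orderModBase (Φ : ErgodicQuantumProcess μ d) (α : ℂ) : ℕ∞ :=
  sInf {N : ℕ∞ | ∃ n : ℕ, 0 < n ∧ α ^ n ∈ Φ.baseEigenvalues ∧ N = n}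

end ErgodicQuantumProcess

/-! ### Complete positivity on two-by-two blocks -/

section Channel

open scoped Matrix.Norms.L2Operator MatrixOrder CStarAlgebra ComplexOrder
open Matrix

variable {d : ℕ}
local notation "𝕄" => Matrix (Fin d) (Fin d) ℂ

/-! Irreducibility produces a faithful stationary state. A weak limit of Cesàro means of the evolved
maximally mixed state yields a nonzero positive `ρ` with eigenvalue 1
(`exists_isEigenmatrix_one_posDef`). The support projection of any such matrix reduces the process,
so `ρ` is positive definite a.e. (`IsEigenmatrix.posDef`). Ergodicity and an extremality argument
then show that every eigenmatrix for 1 is a scalar multiple of `ρ` (`exists_ae_eq_smul`).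

Let `x` be an eigenmatrix for `α` with `|α| = 1`. The operator Schwarz inequality relative to `ρ`
makes `tr(xᴴ ρ⁻¹ x)` nonincreasing along `θ`, hence invariant, because `θ` preserves a finite
measure. So Schwarz is an equality (`schwarz_eq`), and `x` lies in a multiplicative domain
(`map_mul_of_schwarz_eq`): if `z` is an eigenmatrix for `β`, then `xᴴ ρ⁻¹ z` is one for `star α *
β`. For `β = α` the product lies in `ℂ ρ`; this forces nonzero eigenmatrices to be invertible a.e.,
makes `α` simple, and makes `Λ_Φ` a group.

Channels preserve the trace, so `tr x` is either zero a.e. or an eigenfunction of `θ` for `α⁻¹`.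
Eigenmatrices inequivalent modulo `Λ_θ` are therefore orthogonal, at almost every `ω`, for the inner
product `tr(xᴴ ρ⁻¹ z)` on a space of dimension `d ^ 2`, which bounds the quotient. Applied to the
powers of `x ρ⁻¹`, the same orthogonality and Cayley–Hamilton give `N_α ≤ d`. -/

theorem CStarAlgebra.exists_eq_star_mul_self {B : Type*} [CStarAlgebra B] [PartialOrder B]
    [StarOrderedRing B] {b : B} (hb : 0 ≤ b) : ∃ w, b = star w * w :=
  CStarAlgebra.nonneg_iff_eq_star_mul_self.mp hb

theorem CStarMatrix.exists_sum_star_mul_of_nonneg {A : Type*} [CStarAlgebra A] [PartialOrder A]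
    [StarOrderedRing A] {n : Type*} [Fintype n] [DecidableEq n] {N : CStarMatrix n n A}
    (hN : 0 ≤ N) : ∃ W : CStarMatrix n n A, ∀ i j, N i j = ∑ k, star (W k i) * W k j := by
  obtain ⟨W, rfl⟩ := CStarAlgebra.exists_eq_star_mul_self hN
  exact ⟨W, fun i j => by simp [CStarMatrix.mul_apply, CStarMatrix.star_apply]⟩

/-- The part of complete positivity that concerns `2 × 2` blocks. -/
theorem IsQuantumChannel.two_positive {ψ : 𝕄 →ₗ[ℂ] 𝕄} (h : IsQuantumChannel ψ) (a b c e : 𝕄) :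
    (cᴴ * ψ (aᴴ * a) * c + cᴴ * ψ (aᴴ * b) * e +
      (eᴴ * ψ (bᴴ * a) * c + eᴴ * ψ (bᴴ * b) * e)).PosSemidef := by
  obtain ⟨Ψ, hΨ⟩ := h.completelyPositive
  -- `star V * V` is the Gram matrix with blocks `aᴴa`, `aᴴb`, `bᴴa`, `bᴴb`; the zero row only makes
  -- `V` square.
  set V : CStarMatrix (Fin 2) (Fin 2) 𝕄 := CStarMatrix.ofMatrix !![a, b; 0, 0] with hV
  have h0 : 0 ≤ star V * V := star_mul_self_nonneg V
  have h1 := CompletelyPositiveMap.map_cstarMatrix_nonneg Ψ _ h0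
  obtain ⟨W, hW⟩ := CStarMatrix.exists_sum_star_mul_of_nonneg h1
  have key : ∀ i j, ψ ((star V * V) i j) = (W 0 i)ᴴ * W 0 j + (W 1 i)ᴴ * W 1 j := by
    intro i j
    have := hW i j
    rw [CStarMatrix.map_apply, hΨ, Fin.sum_univ_two] at this
    exact this
  have h00 := key 0 0
  have h01 := key 0 1
  have h10 := key 1 0
  have h11 := key 1 1
  simp [CStarMatrix.mul_apply, CStarMatrix.star_apply, hV, Fin.sum_univ_two,
    star_eq_conjTranspose] at h00 h01 h10 h11
  rw [h00, h01, h10, h11]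
  have e1 := posSemidef_conjTranspose_mul_self (W 0 0 * c + W 0 1 * e)
  have e2 := posSemidef_conjTranspose_mul_self (W 1 0 * c + W 1 1 * e)
  convert e1.add e2 using 1
  simp only [conjTranspose_add, conjTranspose_mul]
  noncomm_ring

end Channel

/-! ### Positive semidefinite matrices: entry bounds, closedness, polarization -/

section PosSemidef

open Matrix
open scoped ComplexOrder

variable {n : Type*} [Fintype n]

namespace Matrix

section Factor

open scoped Matrix.Norms.L2Operator MatrixOrder

theorem PosSemidef.exists_eq_conjTranspose_mul_self {A : Matrix n n ℂ} (hA : A.PosSemidef) :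
    ∃ B : Matrix n n ℂ, A = Bᴴ * B := by
  classical
  exact CStarAlgebra.nonneg_iff_eq_star_mul_self.mp hA.nonneg

end Factor

theorem posSemidef_iff_re {A : Matrix n n ℂ} :
    A.PosSemidef ↔ A.IsHermitian ∧ ∀ v : n → ℂ, 0 ≤ (star v ⬝ᵥ (A *ᵥ v)).re := by
  rw [posSemidef_iff_dotProduct_mulVec]
  refine and_congr_right fun hA => forall_congr' fun v => ?_
  have him : (star v ⬝ᵥ (A *ᵥ v)).im = 0 := by
    simpa using hA.im_star_dotProduct_mulVec_self v
  rw [Complex.le_def]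
  simp [him]

/-- Writing `A = Bᴴ B`, the AM-GM inequality bounds each entry by half the sum of two diagonal
entries. A state thus has entries of norm at most 1, the source of all uniform bounds below. -/
theorem PosSemidef.norm_apply_le_trace {A : Matrix n n ℂ} (hA : A.PosSemidef) (i j : n) :
    ‖A i j‖ ≤ A.trace.re := by
  classical
  obtain ⟨B, rfl⟩ := (hA).exists_eq_conjTranspose_mul_self
  have htr : (Bᴴ * B).trace.re = ∑ l, ∑ k, ‖B k l‖ ^ 2 := by
    simp [trace, mul_apply, Complex.conj_mul', ← Complex.ofReal_pow]
  rw [htr, mul_apply]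
  refine (norm_sum_le _ _).trans ?_
  have h1 : ∀ l, ∑ k, ‖B k l‖ ^ 2 ≤ ∑ l, ∑ k, ‖B k l‖ ^ 2 := fun l =>
    Finset.single_le_sum (f := fun l => ∑ k, ‖B k l‖ ^ 2) (fun _ _ => by positivity)
      (Finset.mem_univ l)
  have h2 : ∑ k, ‖Bᴴ i k * B k j‖ ≤ ∑ k, (‖B k i‖ ^ 2 + ‖B k j‖ ^ 2) / 2 := by
    gcongr with k
    simp only [conjTranspose_apply, norm_mul, norm_star]
    nlinarith [sq_nonneg (‖B k i‖ - ‖B k j‖)]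
  rw [← Finset.sum_div, Finset.sum_add_distrib] at h2
  linarith [h1 i, h1 j]

theorem isClosed_setOf_posSemidef : IsClosed {A : Matrix n n ℂ | A.PosSemidef} := by
  simp only [posSemidef_iff_re, Set.ofPred_and, Set.ofPred_forall]
  refine IsClosed.inter (isClosed_eq (by fun_prop) (by fun_prop)) (isClosed_iInter fun v => ?_)
  exact isClosed_le continuous_const (by fun_prop)

theorem PosSemidef.eq_zero_of_neg {A : Matrix n n ℂ} (h₁ : A.PosSemidef) (h₂ : (-A).PosSemidef) :
    A = 0 := by
  classical
  have h := h₂.trace_nonneg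
  rw [trace_neg, neg_nonneg] at h
  exact h₁.trace_eq_zero_iff.mp (le_antisymm h h₁.trace_nonneg)

/-- The cone is closed; let `s → 0`. This isolates first-order terms in the perturbation arguments
for channels. -/
theorem posSemidef_of_forall_pos_smul_add {A B : Matrix n n ℂ}
    (h : ∀ s : ℝ, 0 < s → (A + (s : ℂ) • B).PosSemidef) : A.PosSemidef := by
  have ht : Filter.Tendsto (fun s : ℝ => A + (s : ℂ) • B) (nhdsWithin 0 (Set.Ioi 0)) (nhds A) := by
    have : Continuous fun s : ℝ => A + (s : ℂ) • B := by fun_prop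
    simpa using (this.tendsto 0).mono_left nhdsWithin_le_nhds
  exact isClosed_setOf_posSemidef.mem_of_tendsto ht
    (by filter_upwards [self_mem_nhdsWithin] with s hs using h s hs)

/-- Every matrix is a combination of four positive ones. -/
theorem exists_polarization [DecidableEq n] (x : Matrix n n ℂ) :
    ∃ y₁ y₂ y₃ y₄ : Matrix n n ℂ, (4 : ℂ) • x =
      (y₁ᴴ * y₁ - y₂ᴴ * y₂) + (-Complex.I) • (y₃ᴴ * y₃ - y₄ᴴ * y₄) := by
  refine ⟨1 + x, 1 - x, 1 + Complex.I • x, 1 - Complex.I • x, ?_⟩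
  ext i j
  simp [mul_add, add_mul, mul_sub, sub_mul, mul_apply]
  ring_nf
  simp
  ring

end Matrix

end PosSemidef

/-! ### Quantum channels: Schwarz inequality and multiplicative domain -/

section Channel

open Matrix
open scoped ComplexOrder

variable {d : ℕ} {ψ : Matrix (Fin d) (Fin d) ℂ →ₗ[ℂ] Matrix (Fin d) (Fin d) ℂ}
local notation "𝕄" => Matrix (Fin d) (Fin d) ℂ

namespace IsQuantumChannel

theorem posSemidef_map (h : IsQuantumChannel ψ) {x : 𝕄} (hx : x.PosSemidef) :
    (ψ x).PosSemidef := by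
  obtain ⟨a, rfl⟩ := (hx).exists_eq_conjTranspose_mul_self
  simpa using h.two_positive a 0 1 0

theorem conjTranspose_map (h : IsQuantumChannel ψ) (x : 𝕄) : ψ xᴴ = (ψ x)ᴴ := by
  have hp : ∀ y : 𝕄, (ψ (yᴴ * y))ᴴ = ψ (yᴴ * y) := fun y =>
    (h.posSemidef_map (posSemidef_conjTranspose_mul_self y)).isHermitian
  obtain ⟨y₁, y₂, y₃, y₄, h1⟩ := exists_polarization x
  have hp' : ∀ y : 𝕄, (yᴴ * y)ᴴ = yᴴ * y := fun y => by simp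
  have h2 := congrArg ψ (congrArg conjTranspose h1)
  have h3 := congrArg conjTranspose (congrArg ψ h1)
  rw [conjTranspose_add, conjTranspose_sub, conjTranspose_smul, conjTranspose_smul,
    conjTranspose_sub, hp', hp', hp', hp'] at h2
  simp only [map_add, map_sub, map_smul] at h2 h3
  rw [conjTranspose_add, conjTranspose_sub, conjTranspose_smul, conjTranspose_smul,
    conjTranspose_sub, hp, hp, hp, hp, ← h2] at h3
  exact (smul_right_injective _ (by simp) h3).symm

/-- Polarization reduces to positive matrices, where trace preservation gives a bound independent of
the channel. The uniformity lets the coefficients of a random channel serve as bounded test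
functions. -/
theorem exists_norm_apply_le (x : 𝕄) :
    ∃ K : ℝ, ∀ ψ : 𝕄 →ₗ[ℂ] 𝕄,
      IsQuantumChannel ψ → ∀ i j, ‖ψ x i j‖ ≤ K := by
  have hp : ∀ y : 𝕄, ∀ ψ : 𝕄 →ₗ[ℂ] 𝕄, IsQuantumChannel ψ → ∀ i j,
      ‖ψ (yᴴ * y) i j‖ ≤ (yᴴ * y).trace.re := fun y ψ h i j => by
    rw [← h.trace_map]
    exact (h.posSemidef_map (posSemidef_conjTranspose_mul_self y)).norm_apply_le_trace i j
  obtain ⟨y₁, y₂, y₃, y₄, hy⟩ := exists_polarization x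
  refine ⟨(y₁ᴴ * y₁).trace.re + (y₂ᴴ * y₂).trace.re +
    ((y₃ᴴ * y₃).trace.re + (y₄ᴴ * y₄).trace.re), fun ψ h i j => ?_⟩
  have h1 := congrFun₂ (congrArg ψ hy) i j
  simp only [map_add, map_sub, map_smul, Matrix.add_apply, Matrix.sub_apply, Matrix.smul_apply,
    smul_eq_mul] at h1
  have h2 : ‖ψ x i j‖ ≤ ‖(4 : ℂ) * ψ x i j‖ := by
    rw [norm_mul]
    norm_num
    linarith [norm_nonneg (ψ x i j)]
  rw [h1] at h2
  refine h2.trans ((norm_add_le _ _).trans (add_le_add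
    ((norm_sub_le _ _).trans (add_le_add (hp _ _ h _ _) (hp _ _ h _ _))) ?_))
  rw [norm_mul, norm_neg, Complex.norm_I, one_mul]
  exact (norm_sub_le _ _).trans (add_le_add (hp _ _ h _ _) (hp _ _ h _ _))

/-- If the compression of `ψ (aᴴ a)` to the range of `c` vanishes, then so does `cᴴ ψ (aᴴ b)`. -/
theorem conjTranspose_mul_map_eq_zero (h : IsQuantumChannel ψ) {a c : 𝕄}
    (h0 : cᴴ * ψ (aᴴ * a) * c = 0) (b : 𝕄) : cᴴ * ψ (aᴴ * b) = 0 := by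
  set B := cᴴ * ψ (aᴴ * b) with hB
  have hB' : ψ (bᴴ * a) * c = Bᴴ := by
    rw [hB, conjTranspose_mul, ← h.conjTranspose_map]
    simp
  have key : (-((2 : ℂ) • (B * Bᴴ))).PosSemidef := by
    refine posSemidef_of_forall_pos_smul_add (B := B * ψ (bᴴ * b) * Bᴴ) fun s hs => ?_
    -- With `e = -s Bᴴ` the first-order term is `-2s B Bᴴ`; dividing by `s` and letting `s → 0`
    -- leaves `-2 B Bᴴ ≥ 0`.
    have h1 := h.two_positive a b c (-(s : ℂ) • Bᴴ)
    rw [h0, ← hB, mul_assoc _ (ψ (bᴴ * a)) c, hB'] at h1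
    have h2 := h1.smul (a := ((s : ℂ)⁻¹))
      (by rw [← Complex.ofReal_inv]; exact_mod_cast (inv_pos.mpr hs).le)
    have hs' : (s : ℂ) ≠ 0 := by exact_mod_cast hs.ne'
    have hc : (-(s : ℂ) • Bᴴ)ᴴ = -(s : ℂ) • B := by simp
    rw [hc] at h2
    have e : 0 + B * (-(s : ℂ) • Bᴴ) + ((-(s : ℂ) • B) * Bᴴ +
        (-(s : ℂ) • B) * ψ (bᴴ * b) * (-(s : ℂ) • Bᴴ)) =
        (s : ℂ) • (-((2 : ℂ) • (B * Bᴴ)) + (s : ℂ) • (B * ψ (bᴴ * b) * Bᴴ)) := by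
      simp only [smul_mul_assoc, mul_smul_comm]
      module
    rwa [e, smul_smul, inv_mul_cancel₀ hs', one_smul] at h2
  have := (posSemidef_self_mul_conjTranspose B)
  have h3 : B * Bᴴ = 0 := this.eq_zero_of_neg (by
    have := key.smul (a := (1/2 : ℂ)) (by norm_num [Complex.le_def])
    simpa [smul_smul] using this)
  exact self_mul_conjTranspose_eq_zero.mp h3

/-- A Schur complement: with `ρ = sᴴ s`, the blocks built from `s` and `(sᴴ)⁻¹ x` are `ρ`, `x`,
`xᴴ`, `xᴴ ρ⁻¹ x`, and the column `(-(ψ ρ)⁻¹ ψ x, 1)` minimizes the resulting form. -/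
theorem schwarz (h : IsQuantumChannel ψ) {ρ : 𝕄} (hρ : ρ.PosDef) (hρ' : (ψ ρ).PosDef) (x : 𝕄) :
    (ψ (xᴴ * ρ⁻¹ * x) - (ψ x)ᴴ * (ψ ρ)⁻¹ * ψ x).PosSemidef := by
  obtain ⟨s, hs⟩ := (hρ.posSemidef).exists_eq_conjTranspose_mul_self
  have hu : IsUnit s.det := by
    have := hρ.isUnit
    rw [isUnit_iff_isUnit_det, hs, det_mul] at this
    exact isUnit_of_mul_isUnit_right this
  have hu' : IsUnit sᴴ.det := by rw [det_conjTranspose]; exact hu.star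
  have hv : IsUnit (ψ ρ).det := (isUnit_iff_isUnit_det _).mp hρ'.isUnit
  have e1 : sᴴ * ((sᴴ)⁻¹ * x) = x := mul_nonsing_inv_cancel_left _ _ hu'
  have e2 : ((sᴴ)⁻¹ * x)ᴴ * s = xᴴ := by
    rw [conjTranspose_mul, conjTranspose_nonsing_inv, conjTranspose_conjTranspose,
      nonsing_inv_mul_cancel_right _ _ hu]
  have e3 : ((sᴴ)⁻¹ * x)ᴴ * ((sᴴ)⁻¹ * x) = xᴴ * ρ⁻¹ * x := by
    rw [hs, Matrix.mul_inv_rev, conjTranspose_mul, conjTranspose_nonsing_inv,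
      conjTranspose_conjTranspose]
    simp only [mul_assoc]
  have key := h.two_positive s ((sᴴ)⁻¹ * x) (-((ψ ρ)⁻¹ * ψ x)) 1
  rw [← hs, e1, e2, e3, h.conjTranspose_map] at key
  have hi : ((ψ ρ)⁻¹)ᴴ = (ψ ρ)⁻¹ := hρ'.isHermitian.inv
  convert key using 1
  simp only [conjTranspose_neg, conjTranspose_mul, hi, conjTranspose_one, one_mul, mul_one]
  simp only [neg_mul, mul_neg, neg_neg]
  rw [nonsing_inv_mul_cancel_right _ _ hv]
  simp only [mul_assoc]
  abel

/-- The multiplicative domain of a channel with respect to a faithful state. -/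
theorem map_mul_of_schwarz_eq (h : IsQuantumChannel ψ) {ρ : 𝕄} (hρ : ρ.PosDef)
    (hρ' : (ψ ρ).PosDef) {x : 𝕄} (hx : ψ (xᴴ * ρ⁻¹ * x) = (ψ x)ᴴ * (ψ ρ)⁻¹ * ψ x) (z : 𝕄) :
    ψ (xᴴ * ρ⁻¹ * z) = (ψ x)ᴴ * (ψ ρ)⁻¹ * ψ z := by
  -- The Schwarz defect is a positive sesquilinear form that vanishes at `(x, x)`, so `x` is in its
  -- kernel, as in the Cauchy–Schwarz inequality.
  set D : 𝕄 → 𝕄 → 𝕄 := fun a b => ψ (aᴴ * ρ⁻¹ * b) - (ψ a)ᴴ * (ψ ρ)⁻¹ * ψ b with hD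
  have h0 : D x x = 0 := sub_eq_zero.mpr hx
  have hpos : ∀ z, (D x z + D z x).PosSemidef := fun z => by
    refine posSemidef_of_forall_pos_smul_add (B := D z z) fun s hs => ?_
    have h1 := (h.schwarz hρ hρ' (x + (s : ℂ) • z)).smul (a := ((s : ℂ)⁻¹))
      (by rw [← Complex.ofReal_inv]; exact_mod_cast (inv_pos.mpr hs).le)
    have hs' : (s : ℂ) ≠ 0 := by exact_mod_cast hs.ne'
    have h2 : D (x + (s : ℂ) • z) (x + (s : ℂ) • z) =
        D x x + (s : ℂ) • (D x z + D z x + (s : ℂ) • D z z) := by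
      simp [hD, add_mul, mul_add, smul_sub, smul_add, smul_smul]
      abel
    rw [show _ - _ = D (x + (s : ℂ) • z) (x + (s : ℂ) • z) from rfl, h2, h0, zero_add, smul_smul,
      inv_mul_cancel₀ hs', one_smul] at h1
    exact h1
  have hz : ∀ z, D x z + D z x = 0 := fun z => (hpos z).eq_zero_of_neg (by
    have := hpos (-z)
    convert this using 1
    simp [hD]
    abel)
  have e1 := hz z
  -- Replacing `z` by `i z` turns the vanishing sum into a vanishing difference, so both terms are
  -- zero.
  have e2 := hz (Complex.I • z)
  have e3 : D x (Complex.I • z) + D (Complex.I • z) x = Complex.I • (D x z - D z x) := by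
    simp [hD, smul_sub]
    abel
  rw [e3] at e2
  have e4 : D x z - D z x = 0 := (smul_eq_zero.mp e2).resolve_left Complex.I_ne_zero
  have e5 : (2 : ℂ) • D x z = 0 := by
    have := congrArg₂ (· + ·) e1 e4
    simp only [add_zero] at this
    rw [← this, two_smul]
    abel
  exact sub_eq_zero.mp ((smul_eq_zero.mp e5).resolve_left two_ne_zero)

end IsQuantumChannel

end Channel

/-! ### Spectral calculus and support projections -/

section Spectral

open Matrix Filter Topology
open scoped ComplexOrder

variable {n : Type*} [Fintype n] [DecidableEq n]

namespace Matrix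

/-- The function `f` applied to the eigenvalues of a Hermitian matrix. -/
noncomputable def IsHermitian.spectralFun {A : Matrix n n ℂ} (hA : A.IsHermitian) (f : ℝ → ℝ) :
    Matrix n n ℂ :=
  (hA.eigenvectorUnitary : Matrix n n ℂ) * diagonal (fun i => (f (hA.eigenvalues i) : ℂ)) *
    (hA.eigenvectorUnitary : Matrix n n ℂ)ᴴ

namespace IsHermitian

variable {A : Matrix n n ℂ} (hA : A.IsHermitian) (f g : ℝ → ℝ)

theorem spectralFun_mul : hA.spectralFun f * hA.spectralFun g = hA.spectralFun (f * g) := by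
  have hU : (hA.eigenvectorUnitary : Matrix n n ℂ)ᴴ * (hA.eigenvectorUnitary : Matrix n n ℂ) = 1 :=
    Unitary.coe_star_mul_self _
  simp only [spectralFun]
  rw [show ∀ U D E V : Matrix n n ℂ, U * D * V * (U * E * V) = U * (D * (V * U) * E) * V by
    intros; noncomm_ring, hU, mul_one, diagonal_mul_diagonal]
  simp

theorem conjTranspose_spectralFun : (hA.spectralFun f)ᴴ = hA.spectralFun f := by
  simp only [spectralFun, conjTranspose_mul, conjTranspose_conjTranspose, diagonal_conjTranspose,
    mul_assoc]
  congr 3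
  ext i
  simp

theorem spectralFun_congr (h : ∀ i, f (hA.eigenvalues i) = g (hA.eigenvalues i)) :
    hA.spectralFun f = hA.spectralFun g := by
  simp only [spectralFun, h]

theorem spectralFun_id : hA.spectralFun id = A := by
  conv_rhs => rw [hA.spectral_theorem]
  rfl

theorem spectralFun_const (c : ℝ) : hA.spectralFun (fun _ => c) = (c : ℂ) • 1 := by
  have hU : (hA.eigenvectorUnitary : Matrix n n ℂ) * (hA.eigenvectorUnitary : Matrix n n ℂ)ᴴ = 1 :=
    Unitary.coe_mul_star_self _
  have : diagonal (fun _ : n => (c : ℂ)) = (c : ℂ) • 1 := by ext i j; simp [diagonal, one_apply]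
  simp only [spectralFun]
  rw [this, mul_smul_comm, smul_mul_assoc, mul_one, hU]

theorem spectralFun_sub :
    hA.spectralFun (f - g) = hA.spectralFun f - hA.spectralFun g := by
  simp only [spectralFun]
  rw [← sub_mul, ← mul_sub, diagonal_sub]
  simp

theorem spectralFun_const_mul (c : ℝ) :
    hA.spectralFun (fun t => c * f t) = (c : ℂ) • hA.spectralFun f := by
  have := hA.spectralFun_mul (fun _ => c) f
  rw [spectralFun_const, smul_mul_assoc, one_mul] at this
  exact this.symm

theorem spectralFun_pow (k : ℕ) : hA.spectralFun (f ^ k) = hA.spectralFun f ^ k := by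
  induction k with
  | zero => simpa [Pi.one_def] using hA.spectralFun_const 1
  | succ k ih => rw [pow_succ, pow_succ, ← ih, spectralFun_mul]

theorem posSemidef_spectralFun (h : ∀ i, 0 ≤ f (hA.eigenvalues i)) :
    (hA.spectralFun f).PosSemidef := by
  refine PosSemidef.mul_mul_conjTranspose_same (posSemidef_diagonal_iff.mpr fun i => ?_) _
  exact_mod_cast h i

theorem tendsto_spectralFun {f : ℕ → ℝ → ℝ} {g : ℝ → ℝ}
    (h : ∀ i, Tendsto (fun k => f k (hA.eigenvalues i)) atTop (𝓝 (g (hA.eigenvalues i)))) :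
    Tendsto (fun k => hA.spectralFun (f k)) atTop (𝓝 (hA.spectralFun g)) := by
  have h1 : Tendsto (fun k => fun i => ((f k (hA.eigenvalues i) : ℝ) : ℂ)) atTop
      (𝓝 fun i => ((g (hA.eigenvalues i) : ℝ) : ℂ)) :=
    tendsto_pi_nhds.mpr fun i => (Complex.continuous_ofReal.tendsto _).comp (h i)
  have h2 : Continuous fun v : n → ℂ => (hA.eigenvectorUnitary : Matrix n n ℂ) * diagonal v *
    (hA.eigenvectorUnitary : Matrix n n ℂ)ᴴ := by fun_prop
  exact (h2.tendsto _).comp h1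

theorem exists_nat_sub_posSemidef {A : Matrix n n ℂ} (hA : A.IsHermitian) :
    ∃ k : ℕ, ((k : ℂ) • 1 - A).PosSemidef := by
  obtain ⟨C, hC⟩ := (Set.finite_range hA.eigenvalues).bddAbove
  obtain ⟨k, hk⟩ := exists_nat_ge C
  refine ⟨k, ?_⟩
  have : ((k : ℂ) • 1 - A) = hA.spectralFun ((fun _ => (k : ℝ)) - id) := by
    rw [spectralFun_sub, spectralFun_const, spectralFun_id]
    simp
  rw [this]
  refine hA.posSemidef_spectralFun _ fun i => ?_
  have := hC (Set.mem_range_self i)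
  simp only [Pi.sub_apply, id]
  linarith

end IsHermitian

open Classical in
/-- The orthogonal projection onto the range of a Hermitian matrix (and `0` for other matrices). -/
noncomputable def supportProj (A : Matrix n n ℂ) : Matrix n n ℂ :=
  if h : A.IsHermitian then h.spectralFun (fun t => if t = 0 then 0 else 1) else 0

theorem IsHermitian.supportProj_eq {A : Matrix n n ℂ} (hA : A.IsHermitian) :
    A.supportProj = hA.spectralFun (fun t => if t = 0 then 0 else 1) := by
  simp only [supportProj, hA, dif_pos]

theorem IsHermitian.supportProj_mul {A : Matrix n n ℂ} (hA : A.IsHermitian) :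
    A.supportProj * A = A := by
  have h : hA.spectralFun (fun t => if t = 0 then 0 else 1) * hA.spectralFun id =
      hA.spectralFun id := by
    rw [hA.spectralFun_mul]
    exact hA.spectralFun_congr _ _ fun i => by by_cases h : hA.eigenvalues i = 0 <;> simp [h]
  rwa [hA.spectralFun_id, ← hA.supportProj_eq] at h

theorem IsHermitian.isStarProjection_supportProj {A : Matrix n n ℂ} (hA : A.IsHermitian) :
    IsStarProjection A.supportProj := by
  rw [hA.supportProj_eq]
  refine ⟨?_, hA.conjTranspose_spectralFun _⟩
  rw [IsIdempotentElem, hA.spectralFun_mul]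
  exact hA.spectralFun_congr _ _ fun i => by simp

theorem PosSemidef.exists_sqrt_mul_eq_supportProj {A : Matrix n n ℂ} (hA : A.PosSemidef) :
    ∃ s r : Matrix n n ℂ, sᴴ = s ∧ s * s = A ∧ s * r = A.supportProj := by
  have h := hA.isHermitian
  -- Since `0⁻¹ = 0`, the second matrix is the pseudo-inverse of the square root, and the product is
  -- the support projection rather than the identity.
  refine ⟨h.spectralFun Real.sqrt, h.spectralFun (fun t => (Real.sqrt t)⁻¹),
    h.conjTranspose_spectralFun _, ?_, ?_⟩
  · conv_rhs => rw [← h.spectralFun_id]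
    rw [h.spectralFun_mul]
    exact h.spectralFun_congr _ _ fun i => Real.mul_self_sqrt (hA.eigenvalues_nonneg i)
  · rw [h.spectralFun_mul, h.supportProj_eq]
    refine h.spectralFun_congr _ _ fun i => ?_
    by_cases h0 : h.eigenvalues i = 0
    · simp [h0]
    · have : Real.sqrt (h.eigenvalues i) ≠ 0 :=
        (Real.sqrt_pos.mpr ((hA.eigenvalues_nonneg i).lt_of_ne' h0)).ne'
      simp [h0, this]

theorem PosSemidef.posDef_of_supportProj_eq_one {A : Matrix n n ℂ} (hA : A.PosSemidef)
    (h : A.supportProj = 1) : A.PosDef := by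
  obtain ⟨s, r, -, hs, hr⟩ := hA.exists_sqrt_mul_eq_supportProj
  rw [hA.posDef_iff_isUnit, ← hs]
  have : IsUnit s := IsUnit.of_mul_eq_one r (hr.trans h)
  exact this.mul this

/-- The trace dominates every eigenvalue, so the nonzero eigenvalues of `1 - A / c` lie in `[0, 1)`
apart from the eigenvalue 1 on the kernel of `A`. Writing the projection as a limit of polynomials
in `A` is what makes it measurable in `ω`. -/
theorem PosSemidef.tendsto_supportProj {A : Matrix n n ℂ} (hA : A.PosSemidef) {c : ℝ} (hc : 0 < c)
    (hAc : A.trace = c) :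
    Tendsto (fun k : ℕ => 1 - (1 - ((c⁻¹ : ℝ) : ℂ) • A) ^ k) atTop (𝓝 A.supportProj) := by
  have h := hA.isHermitian
  have hle : ∀ i, h.eigenvalues i ≤ c := fun i => by
    have h1 : (∑ i, h.eigenvalues i) = c := by
      have := h.trace_eq_sum_eigenvalues
      rw [hAc] at this
      apply Complex.ofReal_injective
      rw [this]
      push_cast
      rfl
    rw [← h1]
    exact Finset.single_le_sum (fun j _ => hA.eigenvalues_nonneg j) (Finset.mem_univ i)
  have e : ∀ k : ℕ, 1 - (1 - ((c⁻¹ : ℝ) : ℂ) • A) ^ k =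
      h.spectralFun (fun t => 1 - (1 - c⁻¹ * t) ^ k) := fun k => by
    have h1 : (1 : Matrix n n ℂ) = h.spectralFun (fun _ => 1) := by
      rw [h.spectralFun_const]; simp
    have h2 : 1 - ((c⁻¹ : ℝ) : ℂ) • A = h.spectralFun ((fun _ => 1) - fun t => c⁻¹ * id t) := by
      rw [h.spectralFun_sub, h.spectralFun_const_mul, h.spectralFun_id, ← h1]
    rw [h2, ← h.spectralFun_pow]
    nth_rewrite 1 [h1]
    rw [← h.spectralFun_sub]
    rfl
  simp_rw [e, h.supportProj_eq]
  refine h.tendsto_spectralFun fun i => ?_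
  by_cases h0 : h.eigenvalues i = 0
  · simp [h0]
  · have hpos := (hA.eigenvalues_nonneg i).lt_of_ne' h0
    simp only [h0, if_false]
    have h1 : Tendsto (fun k : ℕ => (1 - c⁻¹ * h.eigenvalues i) ^ k) atTop (𝓝 0) := by
      apply tendsto_pow_atTop_nhds_zero_of_lt_one
      · have := mul_le_mul_of_nonneg_left (hle i) (inv_pos.mpr hc).le
        rw [inv_mul_cancel₀ hc.ne'] at this
        linarith
      · have := mul_pos (inv_pos.mpr hc) hpos
        linarith
    simpa using h1.const_sub 1

/-- Congruence by `s`, where `A = sᴴ s`, reduces the claim to an upper bound for the Hermitian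
matrix `(sᴴ)⁻¹ x s⁻¹`. -/
theorem PosDef.exists_nat_smul_sub_posSemidef {A x : Matrix n n ℂ} (hA : A.PosDef)
    (hx : x.IsHermitian) : ∃ k : ℕ, ((k : ℂ) • A - x).PosSemidef := by
  obtain ⟨s, hs⟩ := hA.posSemidef.exists_eq_conjTranspose_mul_self
  have hu : IsUnit s.det := by
    have := hA.isUnit
    rw [isUnit_iff_isUnit_det, hs, det_mul] at this
    exact isUnit_of_mul_isUnit_right this
  have hu' : IsUnit sᴴ.det := by rw [det_conjTranspose]; exact hu.star
  have hh : ((sᴴ)⁻¹ * x * s⁻¹).IsHermitian := by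
    have := isHermitian_conjTranspose_mul_mul s⁻¹ hx
    rwa [conjTranspose_nonsing_inv] at this
  obtain ⟨k, hk⟩ := hh.exists_nat_sub_posSemidef
  refine ⟨k, ?_⟩
  convert hk.conjTranspose_mul_mul_same s using 1
  rw [mul_sub, sub_mul, mul_smul_comm, smul_mul_assoc, mul_one, ← hs, mul_assoc,
    nonsing_inv_mul_cancel_right _ _ hu, mul_nonsing_inv_cancel_left _ _ hu']

end Matrix

/-- With `s` the square root of `σ`, the complement of the support of `ψ σ` annihilates `ψ (s * s)`,
hence also `ψ (s * b)` for every `b`; elements of the corner have this form because the support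
projection of `σ` factors through `s`. -/
theorem IsQuantumChannel.map_supportProj_mul_mul {d : ℕ}
    {ψ : Matrix (Fin d) (Fin d) ℂ →ₗ[ℂ] Matrix (Fin d) (Fin d) ℂ} (h : IsQuantumChannel ψ)
    {σ : Matrix (Fin d) (Fin d) ℂ} (hσ : σ.PosSemidef) (a : Matrix (Fin d) (Fin d) ℂ) :
    ψ (σ.supportProj * a * σ.supportProj) =
      (ψ σ).supportProj * ψ (σ.supportProj * a * σ.supportProj) * (ψ σ).supportProj := by
  obtain ⟨s, r, hs, hss, hsr⟩ := hσ.exists_sqrt_mul_eq_supportProj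
  have hσ' := (h.posSemidef_map hσ).isHermitian
  have hp := hσ.isHermitian.isStarProjection_supportProj.isSelfAdjoint
  have hp' := hσ'.isStarProjection_supportProj.isSelfAdjoint
  rw [isSelfAdjoint_iff, star_eq_conjTranspose] at hp hp'
  have left : ∀ a, ψ (σ.supportProj * a * σ.supportProj) =
      (ψ σ).supportProj * ψ (σ.supportProj * a * σ.supportProj) := fun a => by
    have h0 : (1 - (ψ σ).supportProj)ᴴ * ψ (sᴴ * s) * (1 - (ψ σ).supportProj) = 0 := by
      rw [hs, hss, conjTranspose_sub, hp', conjTranspose_one, sub_mul, one_mul,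
        hσ'.supportProj_mul, sub_self, zero_mul]
    have h1 := h.conjTranspose_mul_map_eq_zero h0 (r * a * σ.supportProj)
    rw [hs, show s * (r * a * σ.supportProj) = σ.supportProj * a * σ.supportProj by
      rw [← hsr]; simp only [mul_assoc], conjTranspose_sub, hp', conjTranspose_one, sub_mul,
      one_mul, sub_eq_zero] at h1
    exact h1
  have right := congrArg conjTranspose (left aᴴ)
  rw [conjTranspose_mul, ← h.conjTranspose_map, hp'] at right
  simp only [conjTranspose_mul, conjTranspose_conjTranspose, hp, ← mul_assoc] at right
  rw [← left, ← right]

end Spectral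

/-! ### Eigenmatrices for the eigenvalue 1 -/

section InvariantMatrices

open Matrix Filter Topology
open scoped ComplexOrder

variable {Ω : Type*} [MeasurableSpace Ω] {μ : Measure Ω} {d : ℕ}

theorem MeasureTheory.AEStronglyMeasurable.nullMeasurableSet_posSemidef
    {x : Ω → Matrix (Fin d) (Fin d) ℂ} (hx : AEStronglyMeasurable x μ) :
    NullMeasurableSet {ω | (x ω).PosSemidef} μ := by
  let : MeasurableSpace (Matrix (Fin d) (Fin d) ℂ) := borel _
  have : BorelSpace (Matrix (Fin d) (Fin d) ℂ) := ⟨rfl⟩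
  have : TopologicalSpace.PseudoMetrizableSpace (Matrix (Fin d) (Fin d) ℂ) :=
    inferInstanceAs (TopologicalSpace.PseudoMetrizableSpace (Fin d → Fin d → ℂ))
  exact hx.aemeasurable.nullMeasurableSet_preimage isClosed_setOf_posSemidef.measurableSet

theorem MeasureTheory.AEStronglyMeasurable.matrix_inv {x : Ω → Matrix (Fin d) (Fin d) ℂ}
    (hx : AEStronglyMeasurable x μ) : AEStronglyMeasurable (fun ω => (x ω)⁻¹) μ := by
  simp only [Matrix.inv_def, Ring.inverse_eq_inv']
  refine AEStronglyMeasurable.smul (f := fun ω => ((x ω).det)⁻¹) ?_ ?_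
  · have : AEStronglyMeasurable (fun ω => (x ω).det) μ :=
      (Continuous.matrix_det continuous_id).comp_aestronglyMeasurable hx
    exact this.aemeasurable.inv.aestronglyMeasurable
  · exact (Continuous.matrix_adjugate continuous_id).comp_aestronglyMeasurable hx

theorem MeasureTheory.AEStronglyMeasurable.matrix_conjTranspose {x : Ω → Matrix (Fin d) (Fin d) ℂ}
    (hx : AEStronglyMeasurable x μ) : AEStronglyMeasurable (fun ω => (x ω)ᴴ) μ :=
  (Continuous.matrix_conjTranspose continuous_id).comp_aestronglyMeasurable hx

theorem MeasureTheory.AEStronglyMeasurable.matrix_trace {x : Ω → Matrix (Fin d) (Fin d) ℂ}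
    (hx : AEStronglyMeasurable x μ) : AEStronglyMeasurable (fun ω => (x ω).trace) μ :=
  (Continuous.matrix_trace continuous_id).comp_aestronglyMeasurable hx

/-- Composing with the strictly increasing bounded `arctan` makes `g` integrable; the nonnegative
difference then has integral zero. No integrability of `g` is needed. -/
theorem MeasureTheory.MeasurePreserving.ae_eq_of_ae_comp_le [IsFiniteMeasure μ] {T : Ω → Ω}
    (hT : MeasurePreserving T μ μ) {g : Ω → ℝ} (hg : AEStronglyMeasurable g μ)
    (h : ∀ᵐ ω ∂μ, g (T ω) ≤ g ω) : ∀ᵐ ω ∂μ, g (T ω) = g ω := by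
  set k : Ω → ℝ := fun ω => Real.arctan (g ω) with hk
  have hkm : AEStronglyMeasurable k μ :=
    Real.continuous_arctan.comp_aestronglyMeasurable hg
  have hki : Integrable k μ := by
    refine Integrable.of_bound hkm (Real.pi / 2) (ae_of_all _ fun ω => ?_)
    rw [Real.norm_eq_abs, abs_le]
    exact ⟨by linarith [Real.neg_pi_div_two_lt_arctan (g ω)], (Real.arctan_lt_pi_div_two _).le⟩
  have hkT : Integrable (fun ω => k (T ω)) μ := hT.integrable_comp_of_integrable hki
  have hint : ∫ ω, k (T ω) ∂μ = ∫ ω, k ω ∂μ := by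
    have := integral_map hT.aemeasurable (f := k) (by rwa [hT.map_eq])
    rw [hT.map_eq] at this
    exact this.symm
  have h0 : ∫ ω, (k ω - k (T ω)) ∂μ = 0 := by rw [integral_sub hki hkT, hint, sub_self]
  rw [integral_eq_zero_iff_of_nonneg_ae (f := fun ω => k ω - k (T ω)) _ (hki.sub hkT)] at h0
  · filter_upwards [h0] with ω hω
    have : k ω = k (T ω) := sub_eq_zero.mp hω
    exact (Real.arctan_injective this).symm
  · filter_upwards [h] with ω hω
    exact sub_nonneg.mpr (Real.arctan_strictMono.monotone hω)

namespace ErgodicQuantumProcess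

/-- `x` satisfies `φ_{θ(ω)}(x_ω) = α x_{θ(ω)}` for a.e. `ω`. -/
structure IsEigenmatrix (Φ : ErgodicQuantumProcess μ d) (α : ℂ)
    (x : Ω → Matrix (Fin d) (Fin d) ℂ) : Prop where
  aestronglyMeasurable : AEStronglyMeasurable x μ
  map_eq : ∀ᵐ ω ∂μ, Φ.φ (Φ.θ ω) (x ω) = α • x (Φ.θ ω)

variable {Φ : ErgodicQuantumProcess μ d} {α β : ℂ} {x y σ : Ω → Matrix (Fin d) (Fin d) ℂ}

theorem ae_shift (Φ : ErgodicQuantumProcess μ d) {P : Ω → Prop} (h : ∀ᵐ ω ∂μ, P ω) :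
    ∀ᵐ ω ∂μ, P (Φ.θ ω) :=
  Φ.ergodic.quasiMeasurePreserving.ae h

theorem exists_ae_eq_const (Φ : ErgodicQuantumProcess μ d) {g : Ω → ℂ}
    (hg : AEStronglyMeasurable g μ) (h : ∀ᵐ ω ∂μ, g (Φ.θ ω) = g ω) : ∃ c, ∀ᵐ ω ∂μ, g ω = c :=
  Φ.ergodic.quasiErgodic.ae_eq_const_of_ae_eq_comp₀ hg.aemeasurable.nullMeasurable h

namespace IsEigenmatrix

theorem add (hx : Φ.IsEigenmatrix α x) (hy : Φ.IsEigenmatrix α y) :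
    Φ.IsEigenmatrix α (fun ω => x ω + y ω) where
  aestronglyMeasurable := hx.aestronglyMeasurable.add hy.aestronglyMeasurable
  map_eq := by
    filter_upwards [hx.map_eq, hy.map_eq] with ω h₁ h₂
    rw [map_add, h₁, h₂, smul_add]

theorem smul (c : ℂ) (hx : Φ.IsEigenmatrix α x) : Φ.IsEigenmatrix α (fun ω => c • x ω) where
  aestronglyMeasurable := hx.aestronglyMeasurable.const_smul c
  map_eq := by
    filter_upwards [hx.map_eq] with ω h₁
    rw [map_smul, h₁, smul_comm]

theorem sub (hx : Φ.IsEigenmatrix α x) (hy : Φ.IsEigenmatrix α y) :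
    Φ.IsEigenmatrix α (fun ω => x ω - y ω) := by
  simpa [sub_eq_add_neg] using hx.add (hy.smul (-1))

theorem conjTranspose (hx : Φ.IsEigenmatrix α x) :
    Φ.IsEigenmatrix (star α) (fun ω => (x ω)ᴴ) where
  aestronglyMeasurable := hx.aestronglyMeasurable.matrix_conjTranspose
  map_eq := by
    filter_upwards [hx.map_eq] with ω h₁
    rw [(Φ.isQuantumChannel_φ _).conjTranspose_map, h₁, conjTranspose_smul]

theorem trace_eq (hx : Φ.IsEigenmatrix α x) :
    ∀ᵐ ω ∂μ, (x ω).trace = α * (x (Φ.θ ω)).trace := by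
  filter_upwards [hx.map_eq] with ω h
  rw [← (Φ.isQuantumChannel_φ (Φ.θ ω)).trace_map, h, trace_smul, smul_eq_mul]

/-- The support projection of `σ` reduces the process, so irreducibility makes it the identity. The
trace of `σ` is invariant, hence a positive constant; this makes the projection nonzero a.e. and
allows one polynomial approximation for all `ω`. -/
theorem posDef (hΦ : Φ.IsIrreducible) (hσ : Φ.IsEigenmatrix 1 σ)
    (hpos : ∀ᵐ ω ∂μ, (σ ω).PosSemidef) (h0 : ¬ ∀ᵐ ω ∂μ, σ ω = 0) :
    ∀ᵐ ω ∂μ, (σ ω).PosDef := by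
  obtain ⟨c, hc⟩ := Φ.exists_ae_eq_const hσ.aestronglyMeasurable.matrix_trace
    (by filter_upwards [hσ.trace_eq] with ω h using by rw [h, one_mul])
  have : NeBot (ae μ) := by
    by_contra h
    rw [not_neBot] at h
    exact h0 (by rw [h]; trivial)
  have hc0 : 0 ≤ c := by
    obtain ⟨ω, h₁, h₂⟩ := (hc.and hpos).exists
    exact h₁ ▸ h₂.trace_nonneg
  have hc1 : c ≠ 0 := by
    rintro rfl
    refine h0 ?_
    filter_upwards [hc, hpos] with ω h₁ h₂ using h₂.trace_eq_zero_iff.mp h₁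
  obtain ⟨r, hr⟩ : ∃ r : ℝ, c = r :=
    ⟨c.re, Complex.ext rfl (by simpa using (Complex.le_def.mp hc0).2.symm)⟩
  have hr0 : 0 < r := by
    rw [hr] at hc0 hc1
    exact lt_of_le_of_ne (by exact_mod_cast hc0) (by exact_mod_cast hc1.symm)
  have : TopologicalSpace.PseudoMetrizableSpace (Matrix (Fin d) (Fin d) ℂ) :=
    inferInstanceAs (TopologicalSpace.PseudoMetrizableSpace (Fin d → Fin d → ℂ))
  have hmeas : AEStronglyMeasurable (fun ω => (σ ω).supportProj) μ := by
    refine aestronglyMeasurable_of_tendsto_ae atTop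
      (f := fun (k : ℕ) ω => 1 - (1 - ((r⁻¹ : ℝ) : ℂ) • σ ω) ^ k) (fun k => ?_) ?_
    · have : Continuous fun A : Matrix (Fin d) (Fin d) ℂ =>
          1 - (1 - ((r⁻¹ : ℝ) : ℂ) • A) ^ k := by fun_prop
      exact this.comp_aestronglyMeasurable hσ.aestronglyMeasurable
    · filter_upwards [hc, hpos] with ω h₁ h₂
      exact h₂.tendsto_supportProj hr0 (h₁.trans hr)
  set p : RandomMatrix μ d := AEEqFun.mk _ hmeas with hp
  have hpσ : ∀ᵐ ω ∂μ, p ω = (σ ω).supportProj := AEEqFun.coeFn_mk _ hmeas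
  have hproj : IsRandomProjection p := by
    filter_upwards [hpσ, hpos, hc] with ω h₁ h₂ h₃
    rw [h₁]
    refine ⟨fun h => hc1 ?_, h₂.isHermitian.isStarProjection_supportProj⟩
    have := h₂.isHermitian.supportProj_mul
    rw [h, zero_mul] at this
    rw [← h₃, ← this, trace_zero]
  have hred : Φ.Reduces p := by
    filter_upwards [hpσ, Φ.ae_shift hpσ, hpos, hσ.map_eq] with ω h₁ h₂ h₃ h₄ a
    rw [one_smul] at h₄
    rw [h₁, h₂, ← h₄]
    exact ⟨_, (Φ.isQuantumChannel_φ _).map_supportProj_mul_mul h₃ a⟩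
  filter_upwards [hpσ, hpos, hΦ p hproj hred] with ω h₁ h₂ h₃
  exact h₂.posDef_of_supportProj_eq_one (h₁.symm.trans h₃)

/-- Positivity of `k σ - x` propagates along `θ`, so by ergodicity it holds almost surely or almost
never. At a.e. `ω` some `k` works, so the events cannot all be null. This upgrades pointwise
domination to a uniform constant. -/
theorem exists_nat_smul_sub_posSemidef [IsFiniteMeasure μ] (hσ : Φ.IsEigenmatrix 1 σ)
    (hpos : ∀ᵐ ω ∂μ, (σ ω).PosDef) (hx : Φ.IsEigenmatrix 1 x)
    (hherm : ∀ᵐ ω ∂μ, (x ω).IsHermitian) :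
    ∃ k : ℕ, ∀ᵐ ω ∂μ, ((k : ℂ) • σ ω - x ω).PosSemidef := by
  by_contra hcon
  replace hcon := not_exists.mp hcon
  have hnull : ∀ k : ℕ, ∀ᵐ ω ∂μ, ¬ ((k : ℂ) • σ ω - x ω).PosSemidef := fun k => by
    have hy := (hσ.smul (k : ℂ)).sub hx
    have hsub : {ω | ((k : ℂ) • σ ω - x ω).PosSemidef} ≤ᵐ[μ]
        Φ.θ ⁻¹' {ω | ((k : ℂ) • σ ω - x ω).PosSemidef} := by
      filter_upwards [hy.map_eq] with ω h h₁
      have := (Φ.isQuantumChannel_φ (Φ.θ ω)).posSemidef_map h₁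
      rw [h, one_smul] at this
      exact this
    rcases Φ.ergodic.ae_empty_or_univ_of_ae_le_preimage
      hy.aestronglyMeasurable.nullMeasurableSet_posSemidef hsub with h | h
    · rw [eventuallyEq_empty] at h
      exact h
    · rw [eventuallyEq_univ] at h
      exact (hcon k h).elim
  -- The index 0 is arbitrary: a.e. `ω` gives a contradiction.
  refine hcon 0 ?_
  filter_upwards [ae_all_iff.mpr hnull, hpos, hherm] with ω h₁ h₂ h₃
  obtain ⟨k, hk⟩ := h₂.exists_nat_smul_sub_posSemidef h₃
  exact (h₁ k hk).elim

/-- Take the least `c` with `c σ - x ≥ 0`. If this difference were nonzero it would be faithful,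
hence would dominate a positive multiple of `σ`, and `c` could be lowered. -/
theorem exists_ae_eq_real_smul [IsFiniteMeasure μ] [NeZero μ] (hΦ : Φ.IsIrreducible) (hd : 0 < d)
    (hσ : Φ.IsEigenmatrix 1 σ) (hpos : ∀ᵐ ω ∂μ, (σ ω).PosDef) (hx : Φ.IsEigenmatrix 1 x)
    (hherm : ∀ᵐ ω ∂μ, (x ω).IsHermitian) :
    ∃ c : ℝ, ∀ᵐ ω ∂μ, x ω = (c : ℂ) • σ ω := by
  have : Nonempty (Fin d) := ⟨⟨0, hd⟩⟩
  set S : Set ℝ := {t | ∀ᵐ ω ∂μ, ((t : ℂ) • σ ω - x ω).PosSemidef} with hS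
  have hne : S.Nonempty := by
    obtain ⟨k, hk⟩ := hσ.exists_nat_smul_sub_posSemidef hpos hx hherm
    refine ⟨k, ?_⟩
    filter_upwards [hk] with ω h
    rwa [Complex.ofReal_natCast]
  have hbdd : BddBelow S := by
    obtain ⟨k, hk⟩ := hσ.exists_nat_smul_sub_posSemidef hpos (hx.smul (-1))
      (by filter_upwards [hherm] with ω h using by simpa using h.neg)
    refine ⟨-k, fun t ht => ?_⟩
    have ht' : ∀ᵐ ω ∂μ, ((t : ℂ) • σ ω - x ω).PosSemidef := ht
    obtain ⟨ω, h₁, h₂, h₃⟩ := (hk.and (ht'.and hpos)).exists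
    have h4 := (h₁.add h₂).trace_nonneg
    have h5 : (k : ℂ) • σ ω - (-1 : ℂ) • x ω + ((t : ℂ) • σ ω - x ω) = ((k + t : ℝ) : ℂ) • σ ω := by
      push_cast; module
    have h6 := h₃.trace_pos
    rw [h5, trace_smul, smul_eq_mul] at h4
    have h7 : (0 : ℂ) ≤ ((k + t : ℝ) : ℂ) := by
      by_contra hneg
      have h8 : ((k + t : ℝ) : ℂ) < 0 := by
        rw [← Complex.ofReal_zero, Complex.real_le_real, not_le] at hneg
        exact_mod_cast hneg
      exact absurd h4 (not_le_of_gt (mul_neg_of_neg_of_pos h8 h6))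
    have : (0 : ℝ) ≤ k + t := by exact_mod_cast h7
    linarith
  set c := sInf S with hc
  have hcS : ∀ᵐ ω ∂μ, ((c : ℂ) • σ ω - x ω).PosSemidef := by
    obtain ⟨u, -, hu, huS⟩ := exists_seq_tendsto_sInf hne hbdd
    filter_upwards [ae_all_iff.mpr huS] with ω h
    have ht : Tendsto (fun k => (u k : ℂ) • σ ω - x ω) atTop (𝓝 ((c : ℂ) • σ ω - x ω)) := by
      have : Continuous fun t : ℝ => (t : ℂ) • σ ω - x ω := by fun_prop
      exact (this.tendsto _).comp hu
    exact isClosed_setOf_posSemidef.mem_of_tendsto ht (Eventually.of_forall h)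
  have hy := (hσ.smul (c : ℂ)).sub hx
  refine ⟨c, ?_⟩
  by_contra hcon
  have hyp := hy.posDef hΦ hcS (fun h => hcon (by
    filter_upwards [h] with ω h using (sub_eq_zero.mp h).symm))
  obtain ⟨k, hk⟩ := hy.exists_nat_smul_sub_posSemidef hyp hσ
    (by filter_upwards [hpos] with ω h using h.isHermitian)
  -- Using `k + 1` instead of `k` avoids dividing by zero; the extra copy of `c σ - x` is itself
  -- positive.
  have hmem : c - ((k : ℝ) + 1)⁻¹ ∈ S := by
    filter_upwards [hk, hcS] with ω h₁ h₂
    have h3 := (h₁.add h₂).smul (a := (((k : ℝ) + 1)⁻¹ : ℝ))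
      (α := ℂ) (by exact_mod_cast (by positivity : (0 : ℝ) ≤ ((k : ℝ) + 1)⁻¹))
    convert h3 using 1
    have hk0 : ((k : ℂ) + 1) ≠ 0 := by exact_mod_cast Nat.succ_ne_zero k
    have e : (k : ℂ) • ((c : ℂ) • σ ω - x ω) - σ ω + ((c : ℂ) • σ ω - x ω) =
        ((k : ℂ) + 1) • ((c : ℂ) • σ ω - x ω) - σ ω := by module
    rw [e, smul_sub, smul_smul]
    push_cast
    rw [inv_mul_cancel₀ hk0]
    module
  have := csInf_le hbdd hmem
  have h9 : (0 : ℝ) < ((k : ℝ) + 1)⁻¹ := by positivity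
  linarith

theorem exists_ae_eq_smul [IsFiniteMeasure μ] [NeZero μ] (hΦ : Φ.IsIrreducible) (hd : 0 < d)
    (hσ : Φ.IsEigenmatrix 1 σ) (hpos : ∀ᵐ ω ∂μ, (σ ω).PosDef) (hx : Φ.IsEigenmatrix 1 x) :
    ∃ c : ℂ, ∀ᵐ ω ∂μ, x ω = c • σ ω := by
  have hx' : Φ.IsEigenmatrix 1 (fun ω => (x ω)ᴴ) := by simpa using hx.conjTranspose
  obtain ⟨a, ha⟩ := hσ.exists_ae_eq_real_smul hΦ hd hpos (hx.add hx')
    (ae_of_all _ fun ω => isHermitian_add_transpose_self _)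
  obtain ⟨b, hb⟩ := hσ.exists_ae_eq_real_smul hΦ hd hpos ((hx.sub hx').smul Complex.I)
    (ae_of_all _ fun ω => by
      simp only [IsHermitian, conjTranspose_smul, conjTranspose_sub, conjTranspose_conjTranspose]
      simp [smul_sub, neg_add_eq_sub])
  refine ⟨(a - Complex.I * b) / 2, ?_⟩
  filter_upwards [ha, hb] with ω h₁ h₂
  have h3 : x ω - (x ω)ᴴ = (-Complex.I * b) • σ ω := by
    rw [mul_smul, ← h₂, smul_smul]
    simp
  have h4 : x ω = (1 / 2 : ℂ) • ((x ω + (x ω)ᴴ) + (x ω - (x ω)ᴴ)) := by module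
  rw [h4, h₁, h3]
  module

end IsEigenmatrix

end ErgodicQuantumProcess

end InvariantMatrices

/-! ### Weak limits of bounded sequences -/

section WeakLimit

open Filter Topology
open scoped ComplexConjugate InnerProductSpace

variable {Ω : Type*} [MeasurableSpace Ω] {μ : Measure Ω} [IsFiniteMeasure μ]

/-- A uniformly bounded sequence of functions has a weak limit along every ultrafilter. -/
theorem MeasureTheory.exists_weak_limit (U : Ultrafilter ℕ) {f : ℕ → Ω → ℂ}
    (hf : ∀ n, AEStronglyMeasurable (f n) μ) {C : ℝ} (hC : ∀ n ω, ‖f n ω‖ ≤ C) :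
    ∃ g : Ω → ℂ, Integrable g μ ∧ ∀ h : Ω → ℂ, AEStronglyMeasurable h μ → ∀ K : ℝ,
      (∀ ω, ‖h ω‖ ≤ K) →
      Tendsto (fun n => ∫ ω, h ω * f n ω ∂μ) U (𝓝 (∫ ω, h ω * g ω ∂μ)) := by
  have hmem : ∀ n, MemLp (fun ω => conj (f n ω)) 2 μ := fun n =>
    MemLp.of_bound (RCLike.continuous_conj.comp_aestronglyMeasurable (hf n)) C
      (ae_of_all _ fun ω => by simpa using hC n ω)
  -- The conjugate makes the Riesz functional of `F n` equal to `h ↦ ∫ h f n`. Banach–Alaoglu with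
  -- an ultrafilter then gives a limit without separability of `L²`.
  set F : ℕ → Lp ℂ 2 μ := fun n => (hmem n).toLp _ with hF
  have hbound : ∀ n, ‖F n‖ ≤ measureUnivNNReal μ ^ (2 : ENNReal).toReal⁻¹ * |C| := fun n => by
    refine Lp.norm_le_of_ae_bound (abs_nonneg C) ?_
    filter_upwards [(hmem n).coeFn_toLp] with ω hω
    rw [hω]
    simpa using (hC n ω).trans (le_abs_self C)
  set R : ℝ := measureUnivNNReal μ ^ (2 : ENNReal).toReal⁻¹ * |C|
  set ℓ : ℕ → WeakDual ℂ (Lp ℂ 2 μ) := fun n =>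
    StrongDual.toWeakDual (InnerProductSpace.toDual ℂ (Lp ℂ 2 μ) (F n)) with hℓ
  obtain ⟨m, -, hm⟩ := (WeakDual.isCompact_closedBall (𝕜 := ℂ) (E := Lp ℂ 2 μ) 0
    R).ultrafilter_le_nhds (U.map ℓ) (by
      rw [le_principal_iff]
      refine Ultrafilter.mem_map.mpr (Eventually.of_forall fun n => ?_)
      change InnerProductSpace.toDual ℂ (Lp ℂ 2 μ) (F n) ∈ Metric.closedBall 0 R
      rw [mem_closedBall_zero_iff, LinearIsometryEquiv.norm_map]
      exact hbound n)
  set G : Lp ℂ 2 μ := (InnerProductSpace.toDual ℂ (Lp ℂ 2 μ)).symm (WeakDual.toStrongDual m) with hG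
  refine ⟨fun ω => conj (G ω), ?_, fun h hh K hK => ?_⟩
  · have h1 : Integrable G μ := (Lp.memLp G).integrable (by norm_num)
    exact (Complex.conjCLE : ℂ →L[ℝ] ℂ).integrable_comp h1
  have hhm : MemLp h 2 μ := MemLp.of_bound hh K (ae_of_all _ hK)
  have ht : Tendsto (fun n => ℓ n (hhm.toLp h)) U (𝓝 (m (hhm.toLp h))) :=
    ((WeakDual.eval_continuous (hhm.toLp h)).tendsto m).comp hm
  have hinner : ∀ (H : Lp ℂ 2 μ) (k : Ω → ℂ), (∀ᵐ ω ∂μ, H ω = conj (k ω)) →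
      ⟪H, hhm.toLp h⟫_ℂ = ∫ ω, h ω * k ω ∂μ := fun H k hk => by
    rw [L2.inner_def]
    refine integral_congr_ae ?_
    filter_upwards [hhm.coeFn_toLp, hk] with ω h₁ h₂
    rw [h₁, h₂]
    simp
  have e1 : ∀ n, ℓ n (hhm.toLp h) = ∫ ω, h ω * f n ω ∂μ := fun n =>
    hinner (F n) (f n) (hmem n).coeFn_toLp
  have e2 : m (hhm.toLp h) = ∫ ω, h ω * conj (G ω) ∂μ := by
    rw [← hinner G (fun ω => conj (G ω)) (ae_of_all _ fun ω => by simp)]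
    have : m (hhm.toLp h) = InnerProductSpace.toDual ℂ (Lp ℂ 2 μ) G (hhm.toLp h) := by
      rw [hG, LinearIsometryEquiv.apply_symm_apply]
      rfl
    rw [this, InnerProductSpace.toDual_apply_apply]
  simp_rw [e1] at ht
  rwa [e2] at ht

theorem MeasureTheory.exists_weak_limit_matrix {d : ℕ} (U : Ultrafilter ℕ)
    {f : ℕ → Ω → Matrix (Fin d) (Fin d) ℂ}
    (hf : ∀ n i j, AEStronglyMeasurable (fun ω => f n ω i j) μ) {C : ℝ}
    (hC : ∀ n ω i j, ‖f n ω i j‖ ≤ C) :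
    ∃ g : Ω → Matrix (Fin d) (Fin d) ℂ, (∀ i j, Integrable (fun ω => g ω i j) μ) ∧
      ∀ c : Ω → Fin d → Fin d → ℂ, (∀ i j, AEStronglyMeasurable (fun ω => c ω i j) μ) →
      ∀ K : ℝ, (∀ ω i j, ‖c ω i j‖ ≤ K) →
      Tendsto (fun n => ∫ ω, ∑ i, ∑ j, c ω i j * f n ω i j ∂μ) U
        (𝓝 (∫ ω, ∑ i, ∑ j, c ω i j * g ω i j ∂μ)) := by
  choose g hgi hg using fun i j =>
    exists_weak_limit U (fun n => hf n i j) (fun n ω => hC n ω i j)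
  refine ⟨fun ω => Matrix.of fun i j => g i j ω, hgi, fun c hc K hK => ?_⟩
  have hmul : ∀ i j (k : Ω → ℂ), Integrable k μ → Integrable (fun ω => c ω i j * k ω) μ :=
    fun i j k hk => hk.bdd_mul (hc i j) (ae_of_all _ fun ω => hK ω i j)
  have hfi : ∀ n i j, Integrable (fun ω => f n ω i j) μ := fun n i j =>
    Integrable.of_bound (hf n i j) C (ae_of_all _ fun ω => hC n ω i j)
  have e : ∀ k : Ω → Matrix (Fin d) (Fin d) ℂ, (∀ i j, Integrable (fun ω => k ω i j) μ) →
      ∫ ω, ∑ i, ∑ j, c ω i j * k ω i j ∂μ = ∑ i, ∑ j, ∫ ω, c ω i j * k ω i j ∂μ := fun k hk => by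
    rw [integral_finsetSum _ fun i _ => integrable_finsetSum _ fun j _ => hmul i j _ (hk i j)]
    exact Finset.sum_congr rfl fun i _ =>
      integral_finsetSum _ fun j _ => hmul i j _ (hk i j)
  rw [e (fun ω => Matrix.of fun i j => g i j ω) hgi]
  simp_rw [fun n => e _ (hfi n)]
  exact tendsto_finsetSum _ fun i _ => tendsto_finsetSum _ fun j _ =>
    hg i j _ (hc i j) K fun ω => hK ω i j

end WeakLimit

/-! ### Cesàro means of the evolved maximally mixed state -/

section Stationary

open Matrix Filter Topology
open scoped ComplexOrder

variable {Ω : Type*} [MeasurableSpace Ω] {μ : Measure Ω} {d : ℕ}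

namespace ErgodicQuantumProcess

theorem map_apply_eq_sum (ψ : Matrix (Fin d) (Fin d) ℂ →ₗ[ℂ] Matrix (Fin d) (Fin d) ℂ)
    (x : Matrix (Fin d) (Fin d) ℂ) (i j : Fin d) :
    ψ x i j = ∑ k, ∑ l, ψ (single k l 1) i j * x k l := by
  conv_lhs => rw [matrix_eq_sum_single x]
  simp only [map_sum, Matrix.sum_apply]
  refine Finset.sum_congr rfl fun k _ => Finset.sum_congr rfl fun l _ => ?_
  have : single k l (x k l) = x k l • single k l (1 : ℂ) := by simp
  rw [this, map_smul, Matrix.smul_apply, smul_eq_mul, mul_comm]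

/-- The evolution of the maximally mixed state. -/
noncomputable def densitySeq (Φ : ErgodicQuantumProcess μ d) : ℕ → Ω → Matrix (Fin d) (Fin d) ℂ
  | 0 => fun _ => (d : ℂ)⁻¹ • 1
  | k + 1 => fun ω => Φ.φ ω (Φ.densitySeq k (Φ.θ.symm ω))

variable (Φ : ErgodicQuantumProcess μ d)

theorem densitySeq_succ_apply (k : ℕ) (ω : Ω) :
    Φ.densitySeq (k + 1) (Φ.θ ω) = Φ.φ (Φ.θ ω) (Φ.densitySeq k ω) := by
  simp [densitySeq]

theorem posSemidef_densitySeq (k : ℕ) (ω : Ω) : (Φ.densitySeq k ω).PosSemidef := by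
  induction k generalizing ω with
  | zero =>
    refine PosSemidef.one.smul (α := ℂ) ?_
    rw [← Complex.ofReal_natCast, ← Complex.ofReal_inv]
    exact_mod_cast (by positivity : (0 : ℝ) ≤ (d : ℝ)⁻¹)
  | succ k ih => exact (Φ.isQuantumChannel_φ ω).posSemidef_map (ih _)

theorem trace_densitySeq (hd : 0 < d) (k : ℕ) (ω : Ω) : (Φ.densitySeq k ω).trace = 1 := by
  induction k generalizing ω with
  | zero => simp [densitySeq, hd.ne']
  | succ k ih => exact ((Φ.isQuantumChannel_φ ω).trace_map _).trans (ih _)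

theorem measurable_densitySeq (k : ℕ) (i j : Fin d) :
    Measurable fun ω => Φ.densitySeq k ω i j := by
  induction k generalizing i j with
  | zero => exact measurable_const
  | succ k ih =>
    have e : (fun ω => Φ.densitySeq (k + 1) ω i j) = fun ω =>
        ∑ a, ∑ b, Φ.φ ω (single a b 1) i j * Φ.densitySeq k (Φ.θ.symm ω) a b :=
      funext fun ω => map_apply_eq_sum (Φ.φ ω) _ i j
    rw [e]
    exact Finset.measurable_sum _ fun a _ => Finset.measurable_sum _ fun b _ =>
      (Φ.measurable_φ _ i j).mul ((ih a b).comp Φ.θ.symm.measurable)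

/-- The Cesàro means of `densitySeq`. -/
noncomputable def densityMean (n : ℕ) (ω : Ω) : Matrix (Fin d) (Fin d) ℂ :=
  ((n : ℂ) + 1)⁻¹ • ∑ k ∈ Finset.range (n + 1), Φ.densitySeq k ω

theorem posSemidef_densityMean (n : ℕ) (ω : Ω) : (Φ.densityMean n ω).PosSemidef := by
  refine (posSemidef_sum _ fun k _ => Φ.posSemidef_densitySeq k ω).smul (α := ℂ) ?_
  have h : ((n : ℂ) + 1)⁻¹ = (((n : ℝ) + 1)⁻¹ : ℝ) := by push_cast; rfl
  rw [h, Complex.zero_le_real]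
  positivity

theorem trace_densityMean (hd : 0 < d) (n : ℕ) (ω : Ω) : (Φ.densityMean n ω).trace = 1 := by
  have : ((n : ℂ) + 1) ≠ 0 := by exact_mod_cast Nat.succ_ne_zero n
  simp [densityMean, trace_sum, Φ.trace_densitySeq hd, this]

theorem measurable_densityMean (n : ℕ) (i j : Fin d) :
    Measurable fun ω => Φ.densityMean n ω i j := by
  simp only [densityMean, Matrix.smul_apply, Matrix.sum_apply, smul_eq_mul]
  exact (Finset.measurable_sum _ fun k _ => Φ.measurable_densitySeq k i j).const_mul _

theorem norm_densityMean_apply_le (hd : 0 < d) (n : ℕ) (ω : Ω) (i j : Fin d) :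
    ‖Φ.densityMean n ω i j‖ ≤ 1 := by
  simpa [Φ.trace_densityMean hd] using (Φ.posSemidef_densityMean n ω).norm_apply_le_trace i j

/-- The difference telescopes to two states divided by `n + 1`, and states have entries of norm at
most 1. -/
theorem norm_map_densityMean_sub_le (hd : 0 < d) (n : ℕ) (ω : Ω) (i j : Fin d) :
    ‖Φ.φ (Φ.θ ω) (Φ.densityMean n ω) i j - Φ.densityMean n (Φ.θ ω) i j‖ ≤ 2 / ((n : ℝ) + 1) := by
  have e : Φ.φ (Φ.θ ω) (Φ.densityMean n ω) - Φ.densityMean n (Φ.θ ω) =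
      ((n : ℂ) + 1)⁻¹ • (Φ.densitySeq (n + 1) (Φ.θ ω) - Φ.densitySeq 0 (Φ.θ ω)) := by
    simp only [densityMean, map_smul, map_sum, ← densitySeq_succ_apply]
    rw [← smul_sub, ← Finset.sum_sub_distrib, Finset.sum_range_sub
      (fun k => Φ.densitySeq k (Φ.θ ω))]
  rw [← Matrix.sub_apply, e, Matrix.smul_apply, Matrix.sub_apply, smul_eq_mul, norm_mul, norm_inv]
  have h1 : ∀ k, ‖Φ.densitySeq k (Φ.θ ω) i j‖ ≤ 1 := fun k => by
    simpa [Φ.trace_densitySeq hd] using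
      (Φ.posSemidef_densitySeq k (Φ.θ ω)).norm_apply_le_trace i j
  have h2 : ‖(n : ℂ) + 1‖ = (n : ℝ) + 1 := by
    have : ((n : ℂ) + 1) = ((n + 1 : ℕ) : ℂ) := by push_cast; rfl
    rw [this, Complex.norm_natCast]
    push_cast
    rfl
  rw [h2, inv_mul_eq_div]
  gcongr
  exact (norm_sub_le _ _).trans (by linarith [h1 (n + 1), h1 0])

theorem exists_norm_map_single_le (Φ : ErgodicQuantumProcess μ d) :
    ∃ K : ℝ, 0 ≤ K ∧ ∀ ω k l i j, ‖Φ.φ ω (single k l 1) i j‖ ≤ K := by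
  choose K hK using fun k l : Fin d =>
    IsQuantumChannel.exists_norm_apply_le (single k l (1 : ℂ))
  refine ⟨∑ k, ∑ l, |K k l|, by positivity, fun ω k l i j => ?_⟩
  refine ((hK k l _ (Φ.isQuantumChannel_φ ω) i j).trans (le_abs_self _)).trans ?_
  refine (Finset.single_le_sum (f := fun l => |K k l|) (fun _ _ => abs_nonneg _)
    (Finset.mem_univ l)).trans ?_
  exact Finset.single_le_sum (f := fun k => ∑ l, |K k l|) (fun _ _ => by positivity)
    (Finset.mem_univ k)

theorem aestronglyMeasurable_of_apply {x : Ω → Matrix (Fin d) (Fin d) ℂ}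
    (hx : ∀ i j, AEStronglyMeasurable (fun ω => x ω i j) μ) : AEStronglyMeasurable x μ := by
  have : AEMeasurable (β := Fin d → Fin d → ℂ) x μ :=
    aemeasurable_pi_lambda _ fun i => aemeasurable_pi_lambda _ fun j => (hx i j).aemeasurable
  exact this.aestronglyMeasurable (β := Fin d → Fin d → ℂ)

end ErgodicQuantumProcess
end Stationary

/-! ### Existence of a faithful stationary state -/

section Existence

open Matrix Filter Topology
open scoped ComplexOrder

variable {Ω : Type*} [MeasurableSpace Ω] {μ : Measure Ω} {d : ℕ}

theorem Complex.re_integral_nonneg {f : Ω → ℂ} (hf : ∀ ω, 0 ≤ (f ω).re) :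
    0 ≤ (∫ ω, f ω ∂μ).re := by
  by_cases h : Integrable f μ
  · have := integral_re h
    simp only [RCLike.re_to_complex] at this
    rw [← this]
    exact integral_nonneg hf
  · simp [integral_undef h]

theorem MeasureTheory.integral_indicator_one_mul {f : Ω → ℂ} {s : Set Ω} (hs : MeasurableSet s) :
    ∫ ω, s.indicator 1 ω * f ω ∂μ = ∫ ω in s, f ω ∂μ := by
  rw [← integral_indicator hs]
  congr 1
  ext ω
  by_cases h : ω ∈ s <;> simp [h]

theorem Set.norm_indicator_one_le {X : Type*} (s : Set X) (ω : X) :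
    ‖s.indicator (1 : X → ℂ) ω‖ ≤ 1 := by
  by_cases h : ω ∈ s <;> simp [h]

theorem Matrix.star_dotProduct_mulVec_eq_sum {n : Type*} [Fintype n] (A : Matrix n n ℂ)
    (v : n → ℂ) :
    star v ⬝ᵥ (A *ᵥ v) = ∑ i, ∑ j, (star (v i) * v j) * A i j := by
  simp only [dotProduct, mulVec, Finset.mul_sum, Pi.star_apply]
  refine Finset.sum_congr rfl fun i _ => Finset.sum_congr rfl fun j _ => ?_
  ring

namespace ErgodicQuantumProcess

theorem exists_isEigenmatrix_one_posDef [IsProbabilityMeasure μ] {Φ : ErgodicQuantumProcess μ d}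
    (hΦ : Φ.IsIrreducible) (hd : 0 < d) :
    ∃ ρ : Ω → Matrix (Fin d) (Fin d) ℂ, Φ.IsEigenmatrix 1 ρ ∧ ∀ᵐ ω ∂μ, (ρ ω).PosDef := by
  obtain ⟨U, hU⟩ : ∃ U : Ultrafilter ℕ, ↑U ≤ (atTop : Filter ℕ) :=
    ⟨Ultrafilter.of atTop, Ultrafilter.of_le atTop⟩
  have hθ : MeasurePreserving Φ.θ μ μ := Φ.ergodic.toMeasurePreserving
  obtain ⟨g, hgi, hg⟩ := exists_weak_limit_matrix (μ := μ) U (f := Φ.densityMean)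
    (fun n i j => (Φ.measurable_densityMean n i j).aestronglyMeasurable)
    (fun n ω i j => Φ.norm_densityMean_apply_le hd n ω i j)
  have hg₁ : ∀ i j (h : Ω → ℂ), AEStronglyMeasurable h μ → ∀ K : ℝ, (∀ ω, ‖h ω‖ ≤ K) →
      Tendsto (fun n => ∫ ω, h ω * Φ.densityMean n ω i j ∂μ) U
        (𝓝 (∫ ω, h ω * g ω i j ∂μ)) := fun i j h hh K hK => by
    have := hg (fun ω k l => if k = i then if l = j then h ω else 0 else 0)
      (fun k l => by
        by_cases hk : k = i
        · by_cases hl : l = j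
          · simpa [hk, hl] using hh
          · simpa [hk, hl] using aestronglyMeasurable_const
        · simpa [hk] using aestronglyMeasurable_const) K
      (fun ω k l => by
        have h0 : 0 ≤ K := (norm_nonneg _).trans (hK ω)
        split_ifs <;> simp [hK ω, h0])
    simpa [ite_mul] using this
  have hgm : AEStronglyMeasurable g μ :=
    aestronglyMeasurable_of_apply fun i j => (hgi i j).aestronglyMeasurable
  obtain ⟨K, hK0, hK⟩ := Φ.exists_norm_map_single_le
  have hφm : ∀ k l i j, AEStronglyMeasurable (fun ω => Φ.φ (Φ.θ ω) (single k l 1) i j) μ :=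
    fun k l i j => ((Φ.measurable_φ _ i j).comp Φ.θ.measurable).aestronglyMeasurable
  -- Both sides are tested against an indicator `h`. The channel coefficients are absorbed into the
  -- test function on the left, and on the right `θ` is moved onto `h` by invariance of `μ`; so each
  -- side is a weak limit, and the means are asymptotically stationary.
  have hfix : ∀ i j, (fun ω => Φ.φ (Φ.θ ω) (g ω) i j) =ᵐ[μ] fun ω => g (Φ.θ ω) i j := by
    intro i j
    have hFi : Integrable (fun ω => Φ.φ (Φ.θ ω) (g ω) i j) μ := by
      simp_rw [fun ω => map_apply_eq_sum (Φ.φ (Φ.θ ω)) (g ω) i j]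
      exact integrable_finsetSum _ fun k _ => integrable_finsetSum _ fun l _ =>
        (hgi k l).bdd_mul (hφm k l i j) (ae_of_all _ fun ω => hK _ k l i j)
    have hGi : Integrable (fun ω => g (Φ.θ ω) i j) μ := hθ.integrable_comp_of_integrable (hgi i j)
    refine hFi.ae_eq_of_forall_setIntegral_eq _ _ hGi fun s hs _ => ?_
    rw [← integral_indicator_one_mul hs, ← integral_indicator_one_mul hs]
    set h : Ω → ℂ := s.indicator 1 with hh
    have hhm : Measurable h := measurable_one.indicator hs
    have hh1 : ∀ ω, ‖h ω‖ ≤ 1 := s.norm_indicator_one_le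
    have e₁ : ∀ x : Ω → Matrix (Fin d) (Fin d) ℂ, ∫ ω, h ω * Φ.φ (Φ.θ ω) (x ω) i j ∂μ =
        ∫ ω, ∑ k, ∑ l, (h ω * Φ.φ (Φ.θ ω) (single k l 1) i j) * x ω k l ∂μ := fun x => by
      congr 1
      ext ω
      rw [map_apply_eq_sum (Φ.φ (Φ.θ ω)) (x ω) i j]
      simp only [Finset.mul_sum, mul_assoc]
    have e₂ : ∀ x : Ω → Matrix (Fin d) (Fin d) ℂ, ∫ ω, h (Φ.θ.symm ω) * x ω i j ∂μ =
        ∫ ω, h ω * x (Φ.θ ω) i j ∂μ := fun x => by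
      rw [← hθ.integral_comp']
      simp
    have t₁ := hg (fun ω k l => h ω * Φ.φ (Φ.θ ω) (single k l 1) i j)
      (fun k l => hhm.aestronglyMeasurable.mul (hφm k l i j)) K
      (fun ω k l => by
        rw [norm_mul]
        exact (mul_le_mul (hh1 ω) (hK _ k l i j) (norm_nonneg _) zero_le_one).trans_eq (one_mul K))
    have t₂ := hg₁ i j (fun ω => h (Φ.θ.symm ω))
      (hhm.comp Φ.θ.symm.measurable).aestronglyMeasurable 1 (fun ω => hh1 _)
    simp_rw [← e₁] at t₁
    simp_rw [e₂] at t₂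
    have t₃ : Tendsto (fun n => ∫ ω, h ω * Φ.φ (Φ.θ ω) (Φ.densityMean n ω) i j ∂μ -
        ∫ ω, h ω * Φ.densityMean n (Φ.θ ω) i j ∂μ) U (𝓝 0) := by
      have hlim : Tendsto (fun n : ℕ => 2 / ((n : ℝ) + 1)) U (𝓝 0) :=
        ((tendsto_const_nhds (x := (2 : ℝ))).div_atTop
          (tendsto_atTop_add_const_right _ 1 tendsto_natCast_atTop_atTop)).mono_left hU
      refine squeeze_zero_norm (fun n => ?_) hlim
      have hi : ∀ n, Integrable (fun ω => Φ.densityMean n (Φ.θ ω) i j) μ := fun n =>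
        Integrable.of_bound
          ((Φ.measurable_densityMean n i j).comp Φ.θ.measurable).aestronglyMeasurable 1
          (ae_of_all _ fun ω => Φ.norm_densityMean_apply_le hd n _ i j)
      have hi' : ∀ n, Integrable (fun ω => Φ.φ (Φ.θ ω) (Φ.densityMean n ω) i j) μ := fun n => by
        simp_rw [fun ω => map_apply_eq_sum (Φ.φ (Φ.θ ω)) (Φ.densityMean n ω) i j]
        exact integrable_finsetSum _ fun k _ => integrable_finsetSum _ fun l _ =>
          (Integrable.of_bound (Φ.measurable_densityMean n k l).aestronglyMeasurable 1
            (ae_of_all _ fun ω => Φ.norm_densityMean_apply_le hd n _ k l)).bdd_mul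
          (hφm k l i j) (ae_of_all _ fun ω => hK _ k l i j)
      rw [← integral_sub ((hi' n).bdd_mul hhm.aestronglyMeasurable (ae_of_all _ hh1))
        ((hi n).bdd_mul hhm.aestronglyMeasurable (ae_of_all _ hh1))]
      refine (norm_integral_le_of_norm_le_const (C := 2 / ((n : ℝ) + 1))
        (ae_of_all _ fun ω => ?_)).trans_eq (by simp)
      rw [← mul_sub, norm_mul]
      exact (mul_le_mul (hh1 ω) (Φ.norm_map_densityMean_sub_le hd n ω i j) (norm_nonneg _)
        zero_le_one).trans_eq (one_mul _)
    exact sub_eq_zero.mp (tendsto_nhds_unique (t₁.sub t₂) t₃)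
  have heig : Φ.IsEigenmatrix 1 g := ⟨hgm, by
    filter_upwards [ae_all_iff.mpr fun i => ae_all_iff.mpr fun j => hfix i j] with ω h
    rw [one_smul]
    exact Matrix.ext h⟩
  have heig' : Φ.IsEigenmatrix 1 (fun ω => (g ω)ᴴ) := by simpa using heig.conjTranspose
  have hquad : ∀ v : Fin d → ℂ, ∀ᵐ ω ∂μ, 0 ≤ (star v ⬝ᵥ (g ω *ᵥ v)).re := fun v => by
    have hqi : Integrable (fun ω => star v ⬝ᵥ (g ω *ᵥ v)) μ := by
      simp_rw [star_dotProduct_mulVec_eq_sum]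
      exact integrable_finsetSum _ fun i _ => integrable_finsetSum _ fun j _ =>
        (hgi i j).const_mul _
    refine ae_nonneg_of_forall_setIntegral_nonneg hqi.re fun s hs _ => ?_
    have hre := integral_re (hqi.integrableOn (s := s))
    refine le_of_le_of_eq ?_ hre.symm
    rw [← integral_indicator_one_mul hs]
    have e : ∀ x : Ω → Matrix (Fin d) (Fin d) ℂ,
        ∫ ω, s.indicator 1 ω * (star v ⬝ᵥ (x ω *ᵥ v)) ∂μ =
        ∫ ω, ∑ i, ∑ j, (s.indicator 1 ω * (star (v i) * v j)) * x ω i j ∂μ := fun x => by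
      congr 1
      ext ω
      rw [star_dotProduct_mulVec_eq_sum]
      simp only [Finset.mul_sum, mul_assoc]
    have t := hg (fun ω i j => s.indicator 1 ω * (star (v i) * v j))
      (fun i j => ((measurable_one.indicator hs).mul_const _).aestronglyMeasurable) (‖v‖ * ‖v‖)
      (fun ω i j => by
        rw [norm_mul, norm_mul, norm_star]
        refine (mul_le_mul (s.norm_indicator_one_le ω) (mul_le_mul (norm_le_pi_norm v i)
          (norm_le_pi_norm v j) (norm_nonneg _) (norm_nonneg _)) (by positivity)
          zero_le_one).trans_eq (one_mul _))
    simp_rw [← e] at t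
    refine ge_of_tendsto' ((Complex.continuous_re.tendsto _).comp t) fun n => ?_
    refine Complex.re_integral_nonneg fun ω => ?_
    have h1 := (posSemidef_iff_re.mp (Φ.posSemidef_densityMean n ω)).2 v
    by_cases hω : ω ∈ s <;> simp [hω, h1]
  -- The exceptional null set depends on `v`, so a countable dense set of vectors is used, followed
  -- by continuity.
  have hquad' : ∀ᵐ ω ∂μ, ∀ v : Fin d → ℂ, 0 ≤ (star v ⬝ᵥ (g ω *ᵥ v)).re := by
    filter_upwards [ae_all_iff.mpr fun n => hquad (TopologicalSpace.denseSeq (Fin d → ℂ) n)]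
      with ω h v
    have hcl : IsClosed {v : Fin d → ℂ | 0 ≤ (star v ⬝ᵥ (g ω *ᵥ v)).re} :=
      isClosed_le continuous_const (by fun_prop)
    have := hcl.closure_subset_iff.mpr (Set.range_subset_iff.mpr h)
    rw [(TopologicalSpace.denseRange_denseSeq (Fin d → ℂ)).closure_range] at this
    exact this (Set.mem_univ v)
  -- Only real parts of the quadratic forms of `g` are known to be nonnegative; symmetrizing makes
  -- the matrix Hermitian as well. It is not a.e. zero because `∫ tr g = 1`.
  refine ⟨fun ω => g ω + (g ω)ᴴ, heig.add heig', (heig.add heig').posDef hΦ ?_ fun h0 => ?_⟩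
  · filter_upwards [hquad'] with ω h
    refine posSemidef_iff_re.mpr ⟨isHermitian_add_transpose_self _, fun v => ?_⟩
    have h1 : star v ⬝ᵥ ((g ω)ᴴ *ᵥ v) = star (star v ⬝ᵥ (g ω *ᵥ v)) := by
      rw [star_dotProduct, star_mulVec, conjTranspose_conjTranspose, ← dotProduct_mulVec]
    rw [add_mulVec, dotProduct_add, h1, Complex.add_re, Complex.star_def, Complex.conj_re]
    linarith [h v]
  · have htr : ∫ ω, (g ω).trace ∂μ = 1 := by
      have t := hg (fun _ i j => if i = j then 1 else 0) (fun i j => aestronglyMeasurable_const) 1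
        (fun ω i j => by split_ifs <;> simp)
      have e : ∀ x : Matrix (Fin d) (Fin d) ℂ,
          ∑ i, ∑ j, (if i = j then (1 : ℂ) else 0) * x i j = x.trace := fun x => by
        simp [trace]
      simp_rw [e, Φ.trace_densityMean hd] at t
      simpa using tendsto_nhds_unique t tendsto_const_nhds
    have hti : Integrable (fun ω => (g ω).trace) μ :=
      integrable_finsetSum _ fun i _ => hgi i i
    have h1 : ∫ ω, RCLike.re (g ω).trace ∂μ = 0 := by
      rw [← integral_zero Ω ℝ (μ := μ)]
      refine integral_congr_ae ?_
      filter_upwards [h0] with ω h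
      have h2 := congrArg (fun x => (trace x).re) h
      simp only [trace_add, trace_conjTranspose, trace_zero, Complex.add_re, Complex.star_def,
        Complex.conj_re, Complex.zero_re] at h2
      change (g ω).trace.re = 0
      linarith
    rw [integral_re hti, htr] at h1
    simp at h1

end ErgodicQuantumProcess
end Existence

/-! ### Products of eigenmatrices and orthogonality modulo the base eigenvalues -/

section Eigenmatrices

open Matrix Filter Topology
open scoped ComplexOrder

theorem Matrix.PosDef.eq_zero_of_trace_conjTranspose_mul_inv_mul {n : Type*} [Fintype n]
    [DecidableEq n] {A x : Matrix n n ℂ} (hA : A.PosDef) (h : (xᴴ * A⁻¹ * x).trace = 0) :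
    x = 0 := by
  have hA' := hA.inv
  obtain ⟨s, hs⟩ := hA'.posSemidef.exists_eq_conjTranspose_mul_self
  have hu : IsUnit s.det := by
    have := hA'.isUnit
    rw [isUnit_iff_isUnit_det, hs, det_mul] at this
    exact isUnit_of_mul_isUnit_right this
  rw [hs, show xᴴ * (sᴴ * s) * x = (s * x)ᴴ * (s * x) by
    rw [conjTranspose_mul]; simp only [mul_assoc], trace_conjTranspose_mul_self_eq_zero_iff] at h
  rw [← nonsing_inv_mul_cancel_left (A := s) x hu, h, mul_zero]

variable {Ω : Type*} [MeasurableSpace Ω] {μ : Measure Ω} {d : ℕ}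

namespace ErgodicQuantumProcess

variable {Φ : ErgodicQuantumProcess μ d} {α β : ℂ} {ρ x z : Ω → Matrix (Fin d) (Fin d) ℂ}

theorem isEigenmatrix_coeFn_iff {x : RandomMatrix μ d} :
    Φ.IsEigenmatrix α x ↔ x ∈ Φ.eigenspace α :=
  ⟨fun h => h.map_eq, fun h => ⟨x.aestronglyMeasurable, h⟩⟩

theorem IsEigenmatrix.congr (hx : Φ.IsEigenmatrix α x) (h : ∀ᵐ ω ∂μ, z ω = x ω) :
    Φ.IsEigenmatrix α z where
  aestronglyMeasurable := hx.aestronglyMeasurable.congr (h.mono fun _ => Eq.symm)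
  map_eq := by
    filter_upwards [hx.map_eq, h, Φ.ae_shift h] with ω h₁ h₂ h₃
    rw [h₂, h₃, h₁]

theorem mem_peripheralEigenvalues_iff : α ∈ Φ.peripheralEigenvalues ↔
    ‖α‖ = 1 ∧ ∃ x, Φ.IsEigenmatrix α x ∧ ¬ ∀ᵐ ω ∂μ, x ω = 0 := by
  refine and_congr_right fun _ => ⟨?_, ?_⟩
  · rintro ⟨x, hx, h0⟩
    refine ⟨x, isEigenmatrix_coeFn_iff.mpr hx, fun h => h0 ?_⟩
    exact AEEqFun.ext (EventuallyEq.trans h AEEqFun.coeFn_zero.symm)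
  · rintro ⟨x, hx, h0⟩
    have hc := AEEqFun.coeFn_mk x hx.aestronglyMeasurable
    refine ⟨AEEqFun.mk x hx.aestronglyMeasurable, isEigenmatrix_coeFn_iff.mp (hx.congr hc),
      fun h => h0 ?_⟩
    rw [h] at hc
    exact hc.symm.trans AEEqFun.coeFn_zero

theorem mem_baseEigenvalues_iff : β ∈ Φ.baseEigenvalues ↔
    ∃ f : Ω → ℂ, AEStronglyMeasurable f μ ∧ (¬ ∀ᵐ ω ∂μ, f ω = 0) ∧
      ∀ᵐ ω ∂μ, f (Φ.θ ω) = β * f ω := by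
  constructor
  · rintro ⟨f, h0, hf⟩
    refine ⟨f, f.aestronglyMeasurable, fun h => h0 ?_, hf⟩
    exact AEEqFun.ext (EventuallyEq.trans h AEEqFun.coeFn_zero.symm)
  · rintro ⟨f, hm, h0, hf⟩
    have hc := AEEqFun.coeFn_mk f hm
    refine ⟨AEEqFun.mk f hm, fun h => h0 ?_, ?_⟩
    · rw [h] at hc
      exact hc.symm.trans AEEqFun.coeFn_zero
    · filter_upwards [hf, hc, Φ.ae_shift hc] with ω h₁ h₂ h₃
      rw [h₂, h₃, h₁]

/-- Whether `‖β‖ ≤ 1` or `‖β‖ ≥ 1`, the function `‖f‖` is monotone along `θ`, hence invariant, hence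
a nonzero constant by ergodicity. -/
theorem norm_eq_one_and_ae_ne_zero [IsFiniteMeasure μ] {f : Ω → ℂ}
    (hm : AEStronglyMeasurable f μ) (h0 : ¬ ∀ᵐ ω ∂μ, f ω = 0)
    (hf : ∀ᵐ ω ∂μ, f (Φ.θ ω) = β * f ω) : ‖β‖ = 1 ∧ ∀ᵐ ω ∂μ, f ω ≠ 0 := by
  have hθ := Φ.ergodic.toMeasurePreserving
  have hinv : ∀ᵐ ω ∂μ, ‖f (Φ.θ ω)‖ = ‖f ω‖ := by
    rcases le_total ‖β‖ 1 with h | h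
    · refine hθ.ae_eq_of_ae_comp_le hm.norm ?_
      filter_upwards [hf] with ω hω
      rw [hω, norm_mul]
      exact mul_le_of_le_one_left (norm_nonneg _) h
    · have := hθ.ae_eq_of_ae_comp_le hm.norm.neg (by
        filter_upwards [hf] with ω hω
        simp only [Pi.neg_apply, hω, norm_mul]
        exact neg_le_neg (le_mul_of_one_le_left (norm_nonneg _) h))
      filter_upwards [this] with ω hω using neg_injective hω
  obtain ⟨c, hc⟩ := Φ.exists_ae_eq_const (g := fun ω => (‖f ω‖ : ℂ))
    (Complex.continuous_ofReal.comp_aestronglyMeasurable hm.norm)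
    (by filter_upwards [hinv] with ω hω using by rw [hω])
  have hc0 : c ≠ 0 := by
    rintro rfl
    refine h0 ?_
    filter_upwards [hc] with ω hω
    simpa using hω
  have hne : ∀ᵐ ω ∂μ, f ω ≠ 0 := by
    filter_upwards [hc] with ω hω h
    rw [h] at hω
    exact hc0 (by simpa using hω.symm)
  have : NeBot (ae μ) := by
    by_contra h
    rw [not_neBot] at h
    exact h0 (by rw [h]; trivial)
  obtain ⟨ω, h₁, h₂, h₃⟩ := (hne.and (hinv.and hf)).exists
  rw [h₃, norm_mul] at h₂
  exact ⟨mul_right_cancel₀ (norm_ne_zero_iff.mpr h₁) (h₂.trans (one_mul _).symm), hne⟩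

theorem norm_eq_one_of_mem_baseEigenvalues [IsFiniteMeasure μ] (h : β ∈ Φ.baseEigenvalues) :
    ‖β‖ = 1 := by
  obtain ⟨f, hm, h0, hf⟩ := mem_baseEigenvalues_iff.mp h
  exact (norm_eq_one_and_ae_ne_zero hm h0 hf).1

theorem one_mem_baseEigenvalues [NeZero μ] : (1 : ℂ) ∈ Φ.baseEigenvalues :=
  mem_baseEigenvalues_iff.mpr ⟨fun _ => 1, aestronglyMeasurable_const,
    fun h => by simpa using h.exists, ae_of_all _ fun _ => by simp⟩

theorem mul_mem_baseEigenvalues [IsFiniteMeasure μ] (hα : α ∈ Φ.baseEigenvalues)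
    (hβ : β ∈ Φ.baseEigenvalues) : α * β ∈ Φ.baseEigenvalues := by
  obtain ⟨f, hm, h0, hf⟩ := mem_baseEigenvalues_iff.mp hα
  obtain ⟨g, hm', h0', hg⟩ := mem_baseEigenvalues_iff.mp hβ
  refine mem_baseEigenvalues_iff.mpr ⟨fun ω => f ω * g ω, hm.mul hm', fun h => h0 ?_, ?_⟩
  · filter_upwards [h, (norm_eq_one_and_ae_ne_zero hm' h0' hg).2] with ω h₁ h₂
    exact (mul_eq_zero.mp h₁).resolve_right h₂
  · filter_upwards [hf, hg] with ω h₁ h₂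
    rw [h₁, h₂]
    ring

theorem inv_mem_baseEigenvalues [IsFiniteMeasure μ] (hα : α ∈ Φ.baseEigenvalues) :
    α⁻¹ ∈ Φ.baseEigenvalues := by
  obtain ⟨f, hm, h0, hf⟩ := mem_baseEigenvalues_iff.mp hα
  refine mem_baseEigenvalues_iff.mpr ⟨fun ω => (f ω)⁻¹, hm.aemeasurable.inv.aestronglyMeasurable,
    fun h => h0 ?_, ?_⟩
  · filter_upwards [h] with ω h₁ using inv_eq_zero.mp h₁
  · filter_upwards [hf] with ω h₁
    rw [h₁, mul_inv]

namespace IsEigenmatrix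

/-- The Schwarz defect is positive, and its trace is the decrease of `tr(xᴴ ρ⁻¹ x)` from `ω` to `θ
ω`, which vanishes a.e. because `θ` preserves `μ`. A positive matrix of trace zero is zero. -/
theorem schwarz_eq [IsFiniteMeasure μ] (hρ : Φ.IsEigenmatrix 1 ρ)
    (hpos : ∀ᵐ ω ∂μ, (ρ ω).PosDef) (hα : ‖α‖ = 1) (hx : Φ.IsEigenmatrix α x) :
    ∀ᵐ ω ∂μ, Φ.φ (Φ.θ ω) ((x ω)ᴴ * (ρ ω)⁻¹ * x ω) =
      (Φ.φ (Φ.θ ω) (x ω))ᴴ * (Φ.φ (Φ.θ ω) (ρ ω))⁻¹ * Φ.φ (Φ.θ ω) (x ω) := by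
  have hm : AEStronglyMeasurable (fun ω => (x ω)ᴴ * (ρ ω)⁻¹ * x ω) μ :=
    (hx.aestronglyMeasurable.matrix_conjTranspose.mul hρ.aestronglyMeasurable.matrix_inv).mul
      hx.aestronglyMeasurable
  have hαα : star α * α = 1 := by
    rw [Complex.star_def, Complex.conj_mul', hα]
    simp
  have hshift : ∀ᵐ ω ∂μ, (Φ.φ (Φ.θ ω) (x ω))ᴴ * (Φ.φ (Φ.θ ω) (ρ ω))⁻¹ * Φ.φ (Φ.θ ω) (x ω) =
      (x (Φ.θ ω))ᴴ * (ρ (Φ.θ ω))⁻¹ * x (Φ.θ ω) := by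
    filter_upwards [hx.map_eq, hρ.map_eq] with ω h₁ h₂
    rw [h₁, h₂, one_smul, conjTranspose_smul, smul_mul_assoc, smul_mul_assoc, mul_smul_comm,
      smul_smul, hαα, one_smul]
  have hschwarz : ∀ᵐ ω ∂μ, (Φ.φ (Φ.θ ω) ((x ω)ᴴ * (ρ ω)⁻¹ * x ω) -
      (x (Φ.θ ω))ᴴ * (ρ (Φ.θ ω))⁻¹ * x (Φ.θ ω)).PosSemidef := by
    filter_upwards [hshift, hρ.map_eq, hpos, Φ.ae_shift hpos] with ω h₁ h₂ h₃ h₄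
    rw [← h₁]
    exact (Φ.isQuantumChannel_φ _).schwarz h₃ (by rwa [h₂, one_smul]) _
  have hle := Φ.ergodic.toMeasurePreserving.ae_eq_of_ae_comp_le
    (g := fun ω => ((x ω)ᴴ * (ρ ω)⁻¹ * x ω).trace.re)
    (Complex.continuous_re.comp_aestronglyMeasurable hm.matrix_trace) (by
      filter_upwards [hschwarz] with ω h
      have := h.trace_nonneg
      rw [trace_sub, (Φ.isQuantumChannel_φ _).trace_map, Complex.le_def, Complex.sub_re] at this
      exact sub_nonneg.mp this.1)
  filter_upwards [hschwarz, hle, hshift] with ω h₁ h₂ h₃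
  rw [h₃]
  refine sub_eq_zero.mp (h₁.trace_eq_zero_iff.mp (Complex.ext ?_ ?_))
  · rw [trace_sub, (Φ.isQuantumChannel_φ _).trace_map, Complex.sub_re, h₂, sub_self,
      Complex.zero_re]
  · exact (Complex.le_def.mp h₁.trace_nonneg).2.symm

/-- The product of eigenmatrices with respect to a faithful stationary state. -/
theorem conjTranspose_mul_inv_mul [IsFiniteMeasure μ] (hρ : Φ.IsEigenmatrix 1 ρ)
    (hpos : ∀ᵐ ω ∂μ, (ρ ω).PosDef) (hα : ‖α‖ = 1) (hx : Φ.IsEigenmatrix α x)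
    (hz : Φ.IsEigenmatrix β z) :
    Φ.IsEigenmatrix (star α * β) (fun ω => (x ω)ᴴ * (ρ ω)⁻¹ * z ω) where
  aestronglyMeasurable :=
    (hx.aestronglyMeasurable.matrix_conjTranspose.mul hρ.aestronglyMeasurable.matrix_inv).mul
      hz.aestronglyMeasurable
  map_eq := by
    filter_upwards [hρ.schwarz_eq hpos hα hx, hpos, Φ.ae_shift hpos, hρ.map_eq, hx.map_eq,
      hz.map_eq] with ω h₁ h₂ h₃ h₄ h₅ h₆
    rw [(Φ.isQuantumChannel_φ _).map_mul_of_schwarz_eq h₂ (by rwa [h₄, one_smul]) h₁, h₄, h₅, h₆,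
      one_smul, conjTranspose_smul, smul_mul_assoc, smul_mul_assoc, mul_smul_comm, smul_smul]

/-- `xᴴ ρ⁻¹ x` has eigenvalue `star α * α = 1`, so it is a multiple of `ρ`, with nonzero factor by
definiteness; take determinants. -/
theorem ae_isUnit_det [IsFiniteMeasure μ] [NeZero μ] (hΦ : Φ.IsIrreducible) (hd : 0 < d)
    (hρ : Φ.IsEigenmatrix 1 ρ) (hpos : ∀ᵐ ω ∂μ, (ρ ω).PosDef) (hα : ‖α‖ = 1)
    (hx : Φ.IsEigenmatrix α x) (h0 : ¬ ∀ᵐ ω ∂μ, x ω = 0) : ∀ᵐ ω ∂μ, IsUnit (x ω).det := by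
  have hαα : star α * α = 1 := by
    rw [Complex.star_def, Complex.conj_mul', hα]
    simp
  have hy := hρ.conjTranspose_mul_inv_mul hpos hα hx hx
  rw [hαα] at hy
  obtain ⟨c, hc⟩ := hρ.exists_ae_eq_smul hΦ hd hpos hy
  have hc0 : c ≠ 0 := by
    rintro rfl
    refine h0 ?_
    filter_upwards [hc, hpos] with ω h₁ h₂
    exact h₂.eq_zero_of_trace_conjTranspose_mul_inv_mul (by rw [h₁, zero_smul, trace_zero])
  filter_upwards [hc, hpos] with ω h₁ h₂
  have h3 := congrArg det h₁
  rw [det_mul, det_smul] at h3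
  refine isUnit_of_mul_isUnit_right (x := ((x ω)ᴴ * (ρ ω)⁻¹).det) ?_
  rw [h3, isUnit_iff_ne_zero]
  exact mul_ne_zero (pow_ne_zero _ hc0) ((isUnit_iff_isUnit_det _).mp h₂.isUnit).ne_zero

/-- Both `xᴴ ρ⁻¹ x` and `xᴴ ρ⁻¹ z` are multiples of `ρ`; cancel the invertible factor `xᴴ ρ⁻¹`. -/
theorem exists_ae_eq_smul_of_not_ae_zero [IsFiniteMeasure μ] [NeZero μ] (hΦ : Φ.IsIrreducible)
    (hd : 0 < d) (hρ : Φ.IsEigenmatrix 1 ρ) (hpos : ∀ᵐ ω ∂μ, (ρ ω).PosDef) (hα : ‖α‖ = 1)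
    (hx : Φ.IsEigenmatrix α x) (h0 : ¬ ∀ᵐ ω ∂μ, x ω = 0) (hz : Φ.IsEigenmatrix α z) :
    ∃ c : ℂ, ∀ᵐ ω ∂μ, z ω = c • x ω := by
  have hαα : star α * α = 1 := by
    rw [Complex.star_def, Complex.conj_mul', hα]
    simp
  have hxx := hρ.conjTranspose_mul_inv_mul hpos hα hx hx
  have hxz := hρ.conjTranspose_mul_inv_mul hpos hα hx hz
  rw [hαα] at hxx hxz
  obtain ⟨a, ha⟩ := hρ.exists_ae_eq_smul hΦ hd hpos hxx
  obtain ⟨b, hb⟩ := hρ.exists_ae_eq_smul hΦ hd hpos hxz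
  have ha0 : a ≠ 0 := by
    rintro rfl
    refine h0 ?_
    filter_upwards [ha, hpos] with ω h₁ h₂
    exact h₂.eq_zero_of_trace_conjTranspose_mul_inv_mul (by rw [h₁, zero_smul, trace_zero])
  refine ⟨b / a, ?_⟩
  filter_upwards [ha, hb, hpos, hρ.ae_isUnit_det hΦ hd hpos hα hx h0] with ω h₁ h₂ h₃ h₄
  have hu : IsUnit ((x ω)ᴴ * (ρ ω)⁻¹) := by
    refine IsUnit.mul ?_ h₃.inv.isUnit
    rw [isUnit_iff_isUnit_det, det_conjTranspose]
    exact h₄.star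
  refine hu.mul_left_cancel ?_
  rw [h₂, mul_smul_comm, h₁, smul_smul, div_mul_cancel₀ _ ha0]

theorem ae_trace_eq_zero [IsFiniteMeasure μ] (hx : Φ.IsEigenmatrix α x) (hα : α ≠ 0)
    (h : α⁻¹ ∉ Φ.baseEigenvalues) : ∀ᵐ ω ∂μ, (x ω).trace = 0 := by
  by_contra h0
  refine h (mem_baseEigenvalues_iff.mpr
    ⟨fun ω => (x ω).trace, hx.aestronglyMeasurable.matrix_trace, h0, ?_⟩)
  filter_upwards [hx.trace_eq] with ω hω
  rw [hω, inv_mul_cancel_left₀ hα]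

theorem pow [IsFiniteMeasure μ] (hρ : Φ.IsEigenmatrix 1 ρ) (hpos : ∀ᵐ ω ∂μ, (ρ ω).PosDef)
    (hα : ‖α‖ = 1) (hx : Φ.IsEigenmatrix α x) (k : ℕ) :
    Φ.IsEigenmatrix (α ^ k) (fun ω => (x ω * (ρ ω)⁻¹) ^ k * ρ ω) := by
  induction k with
  | zero => simpa using hρ
  | succ k ih =>
    have := hρ.conjTranspose_mul_inv_mul hpos (by rwa [norm_star]) hx.conjTranspose ih
    simpa only [conjTranspose_conjTranspose, star_star, ← mul_assoc, ← pow_succ'] using this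

end IsEigenmatrix

theorem mem_peripheralEigenvalues_of_mem_baseEigenvalues [IsFiniteMeasure μ] [NeZero μ]
    (hd : 0 < d) (hρ : Φ.IsEigenmatrix 1 ρ) (hpos : ∀ᵐ ω ∂μ, (ρ ω).PosDef)
    (h : β ∈ Φ.baseEigenvalues) : β ∈ Φ.peripheralEigenvalues := by
  have : Nonempty (Fin d) := ⟨⟨0, hd⟩⟩
  -- The inverse is needed because in `(*)` the eigenvalue multiplies the shifted matrix: `f • ρ`
  -- has eigenvalue `β` when `f ∘ θ = β⁻¹ f`.
  obtain ⟨f, hm, h0, hf⟩ := mem_baseEigenvalues_iff.mp (inv_mem_baseEigenvalues h)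
  have hβ := norm_eq_one_of_mem_baseEigenvalues h
  have hβ0 : β ≠ 0 := by
    rintro rfl
    simp at hβ
  refine mem_peripheralEigenvalues_iff.mpr ⟨hβ, fun ω => f ω • ρ ω,
    ⟨hm.smul hρ.aestronglyMeasurable, ?_⟩, fun h' => h0 ?_⟩
  · filter_upwards [hf, hρ.map_eq] with ω h₁ h₂
    rw [map_smul, h₂, h₁, one_smul, smul_smul, mul_inv_cancel_left₀ hβ0]
  · filter_upwards [h', hpos] with ω h₁ h₂
    refine (smul_eq_zero.mp h₁).resolve_right fun h => ?_
    have := h₂.trace_pos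
    rw [h, trace_zero] at this
    exact lt_irrefl _ this

theorem star_mul_mem_peripheralEigenvalues [IsFiniteMeasure μ] [NeZero μ] (hΦ : Φ.IsIrreducible)
    (hd : 0 < d) (hρ : Φ.IsEigenmatrix 1 ρ) (hpos : ∀ᵐ ω ∂μ, (ρ ω).PosDef)
    (hα : α ∈ Φ.peripheralEigenvalues) (hβ : β ∈ Φ.peripheralEigenvalues) :
    star α * β ∈ Φ.peripheralEigenvalues := by
  obtain ⟨hα1, x, hx, hx0⟩ := mem_peripheralEigenvalues_iff.mp hα
  obtain ⟨hβ1, z, hz, hz0⟩ := mem_peripheralEigenvalues_iff.mp hβ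
  refine mem_peripheralEigenvalues_iff.mpr ⟨by rw [norm_mul, norm_star, hα1, hβ1, one_mul],
    _, hρ.conjTranspose_mul_inv_mul hpos hα1 hx hz, fun h => hz0 ?_⟩
  filter_upwards [h, hpos, hρ.ae_isUnit_det hΦ hd hpos hα1 hx hx0] with ω h₁ h₃ h₄
  have hu : IsUnit ((x ω)ᴴ * (ρ ω)⁻¹) := by
    refine IsUnit.mul ?_ h₃.inv.isUnit
    rw [isUnit_iff_isUnit_det, det_conjTranspose]
    exact h₄.star
  exact hu.mul_left_cancel (h₁.trans (mul_zero _).symm)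

/-- Eigenmatrices whose eigenvalues are pairwise inequivalent modulo `Λ_θ` are linearly
independent almost surely, so that there are at most `d ^ 2` of them. -/
theorem card_le_of_pairwise_notMem_baseEigenvalues [IsFiniteMeasure μ] [NeZero μ]
    (hρ : Φ.IsEigenmatrix 1 ρ) (hpos : ∀ᵐ ω ∂μ, (ρ ω).PosDef)
    (hΦ : Φ.IsIrreducible) (hd : 0 < d) {ι : Type*} [Fintype ι] (a : ι → ℂ)
    (ha : ∀ i, a i ∈ Φ.peripheralEigenvalues)
    (hne : ∀ i j, i ≠ j → (star (a i) * a j)⁻¹ ∉ Φ.baseEigenvalues) :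
    Fintype.card ι ≤ d ^ 2 := by
  have : Nonempty (Fin d) := ⟨⟨0, hd⟩⟩
  choose h1 x hx h0 using fun i => mem_peripheralEigenvalues_iff.mp (ha i)
  have hane : ∀ i, a i ≠ 0 := fun i h => by simpa [h] using h1 i
  have hort : ∀ᵐ ω ∂μ, ∀ i j, i ≠ j → ((x i ω)ᴴ * (ρ ω)⁻¹ * x j ω).trace = 0 := by
    refine ae_all_iff.mpr fun i => ae_all_iff.mpr fun j => ?_
    by_cases hij : i = j
    · exact ae_of_all _ fun ω h => (h hij).elim
    · filter_upwards [(hρ.conjTranspose_mul_inv_mul hpos (h1 i) (hx i) (hx j)).ae_trace_eq_zero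
        (mul_ne_zero (star_ne_zero.mpr (hane i)) (hane j)) (hne i j hij)] with ω h _ using h
  have hunit : ∀ᵐ ω ∂μ, ∀ i, IsUnit (x i ω).det :=
    ae_all_iff.mpr fun i => hρ.ae_isUnit_det hΦ hd hpos (h1 i) (hx i) (h0 i)
  obtain ⟨ω, ho, hu, hp⟩ := (hort.and (hunit.and hpos)).exists
  have hli : LinearIndependent ℂ fun i => x i ω := by
    refine Fintype.linearIndependent_iff.mpr fun c hc i => ?_
    have h2 := congrArg (fun y => ((x i ω)ᴴ * (ρ ω)⁻¹ * y).trace) hc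
    simp only [Finset.mul_sum, trace_sum, mul_smul_comm, trace_smul, mul_zero, trace_zero] at h2
    rw [Finset.sum_eq_single i (fun j _ hj => by rw [ho i j hj.symm, smul_zero])
      (fun h => (h (Finset.mem_univ i)).elim), smul_eq_zero] at h2
    refine h2.resolve_right fun h => ?_
    have := hu i
    rw [hp.eq_zero_of_trace_conjTranspose_mul_inv_mul h, det_zero] at this
    exact not_isUnit_zero this
  have := hli.fintype_card_le_finrank
  rwa [Module.finrank_matrix, Fintype.card_fin, Module.finrank_self, mul_one, ← sq] at this

/-- If no power `α ^ n` with `1 ≤ n ≤ d` lies in `Λ_θ`, then with `g = x ρ⁻¹` the matrix `g ^ d ρ`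
is orthogonal to all `g ^ k ρ`, `k < d`. By Cayley–Hamilton it is also a combination of them, so it
vanishes, although `g` and `ρ` are invertible. -/
theorem exists_pow_mem_baseEigenvalues [IsFiniteMeasure μ] [NeZero μ]
    (hρ : Φ.IsEigenmatrix 1 ρ) (hpos : ∀ᵐ ω ∂μ, (ρ ω).PosDef)
    (hΦ : Φ.IsIrreducible) (hd : 0 < d) (hα : α ∈ Φ.peripheralEigenvalues) :
    ∃ n : ℕ, 0 < n ∧ n ≤ d ∧ α ^ n ∈ Φ.baseEigenvalues := by
  have hne : Nonempty (Fin d) := ⟨⟨0, hd⟩⟩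
  by_contra! hcon
  obtain ⟨h1, x, hx, h0⟩ := mem_peripheralEigenvalues_iff.mp hα
  have hα0 : α ≠ 0 := fun h => by simp [h] at h1
  have hαα : star α = α⁻¹ := by
    refine eq_inv_of_mul_eq_one_left ?_
    rw [Complex.star_def, Complex.conj_mul', h1]
    simp
  have hort : ∀ᵐ ω ∂μ, ∀ k : ℕ, k < d →
      (((x ω * (ρ ω)⁻¹) ^ d * ρ ω)ᴴ * (ρ ω)⁻¹ * ((x ω * (ρ ω)⁻¹) ^ k * ρ ω)).trace = 0 := by
    refine ae_all_iff.mpr fun k => ?_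
    by_cases hk : k < d
    · filter_upwards [(hρ.conjTranspose_mul_inv_mul hpos (by rw [norm_pow, h1, one_pow])
        (hρ.pow hpos h1 hx d) (hρ.pow hpos h1 hx k)).ae_trace_eq_zero
        (mul_ne_zero (star_ne_zero.mpr (pow_ne_zero _ hα0)) (pow_ne_zero _ hα0)) (by
          have : (star (α ^ d) * α ^ k)⁻¹ = α ^ (d - k) := by
            rw [star_pow, hαα, pow_sub₀ _ hα0 hk.le, mul_inv, inv_pow, inv_inv]
          rw [this]
          exact hcon _ (Nat.sub_pos_of_lt hk) (Nat.sub_le _ _))] with ω h _ using h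
    · exact ae_of_all _ fun ω h => (hk h).elim
  obtain ⟨ω, ho, hu, hp⟩ :=
    (hort.and ((hρ.ae_isUnit_det hΦ hd hpos h1 hx h0).and hpos)).exists
  set g := x ω * (ρ ω)⁻¹ with hg
  have hch := aeval_self_charpoly g
  rw [Polynomial.aeval_eq_sum_range, charpoly_natDegree_eq_dim, Fintype.card_fin,
    Finset.sum_range_succ] at hch
  have hlead : g.charpoly.coeff d = 1 := by
    have := g.charpoly_monic.coeff_natDegree
    rwa [charpoly_natDegree_eq_dim, Fintype.card_fin] at this
  rw [hlead, one_smul] at hch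
  have h2 := congrArg (fun y => ((g ^ d * ρ ω)ᴴ * (ρ ω)⁻¹ * (y * ρ ω)).trace) hch
  simp only [add_mul, mul_add, Finset.sum_mul, Finset.mul_sum, smul_mul_assoc, mul_smul_comm,
    trace_add, trace_sum, trace_smul, zero_mul, mul_zero, trace_zero] at h2
  rw [Finset.sum_eq_zero (fun k hk => by rw [ho k (Finset.mem_range.mp hk), smul_zero]),
    zero_add] at h2
  have h3 := hp.eq_zero_of_trace_conjTranspose_mul_inv_mul h2
  have hgu : IsUnit (g ^ d * ρ ω) :=
    ((((isUnit_iff_isUnit_det _).mpr hu).mul hp.inv.isUnit).pow d).mul hp.isUnit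
  rw [h3] at hgu
  exact not_isUnit_zero hgu

end ErgodicQuantumProcess

end Eigenmatrices

/-! ### Group structure and the quotient -/

section Eigenvalues

open scoped ComplexOrder

namespace ErgodicQuantumProcess

variable {Ω : Type*} [MeasurableSpace Ω] {μ : Measure Ω} {d : ℕ} {Φ : ErgodicQuantumProcess μ d}
  {α : ℂ} {ρ : Ω → Matrix (Fin d) (Fin d) ℂ}

theorem star_eq_inv_of_norm_eq_one {α : ℂ} (h : ‖α‖ = 1) : star α = α⁻¹ := by
  refine eq_inv_of_mul_eq_one_left ?_
  rw [Complex.star_def, Complex.conj_mul', h]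
  simp

theorem finrank_eigenspace_eq_one [IsFiniteMeasure μ] [NeZero μ] (hΦ : Φ.IsIrreducible)
    (hd : 0 < d) (hρ : Φ.IsEigenmatrix 1 ρ) (hpos : ∀ᵐ ω ∂μ, (ρ ω).PosDef)
    (hα : α ∈ Φ.peripheralEigenvalues) : Module.finrank ℂ (Φ.eigenspace α) = 1 := by
  obtain ⟨h1, x, hx, h0⟩ := hα
  refine finrank_eq_one_iff_of_nonzero' (⟨x, hx⟩ : Φ.eigenspace α)
    (fun h => h0 (congrArg Subtype.val h)) |>.mpr fun z => ?_
  obtain ⟨c, hc⟩ := hρ.exists_ae_eq_smul_of_not_ae_zero hΦ hd hpos h1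
    (isEigenmatrix_coeFn_iff.mpr hx)
    (fun h => h0 (AEEqFun.ext (Filter.EventuallyEq.trans h AEEqFun.coeFn_zero.symm)))
    (isEigenmatrix_coeFn_iff.mpr z.2)
  refine ⟨c, Subtype.ext (AEEqFun.ext ?_)⟩
  filter_upwards [AEEqFun.coeFn_smul c x, hc] with ω h₁ h₂
  exact h₁.trans h₂.symm

/-- `Λ_Φ` as a group of units. -/
def peripheralSubgroup [IsFiniteMeasure μ] [NeZero μ] (hΦ : Φ.IsIrreducible)
    (hd : 0 < d) (hρ : Φ.IsEigenmatrix 1 ρ) (hpos : ∀ᵐ ω ∂μ, (ρ ω).PosDef) : Subgroup ℂˣ where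
  carrier := {u | (u : ℂ) ∈ Φ.peripheralEigenvalues}
  one_mem' := mem_peripheralEigenvalues_of_mem_baseEigenvalues hd hρ hpos one_mem_baseEigenvalues
  inv_mem' {u} hu := by
    have := star_mul_mem_peripheralEigenvalues hΦ hd hρ hpos hu
      (mem_peripheralEigenvalues_of_mem_baseEigenvalues hd hρ hpos one_mem_baseEigenvalues)
    rw [mul_one, star_eq_inv_of_norm_eq_one hu.1] at this
    simpa using this
  mul_mem' {u v} hu hv := by
    -- Closure is known only under `star α * β`; the product is recovered as `star (star α * 1) *
    -- β`.
    have h1 := star_mul_mem_peripheralEigenvalues hΦ hd hρ hpos hu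
      (mem_peripheralEigenvalues_of_mem_baseEigenvalues hd hρ hpos one_mem_baseEigenvalues)
    have h2 := star_mul_mem_peripheralEigenvalues hΦ hd hρ hpos h1 hv
    rw [mul_one, star_star] at h2
    simpa using h2

/-- `Λ_θ` as a group of units. -/
def baseSubgroup (Φ : ErgodicQuantumProcess μ d) [IsFiniteMeasure μ] [NeZero μ] :
    Subgroup ℂˣ where
  carrier := {u | (u : ℂ) ∈ Φ.baseEigenvalues}
  one_mem' := one_mem_baseEigenvalues
  inv_mem' {u} hu := by simpa using inv_mem_baseEigenvalues hu
  mul_mem' {u v} hu hv := by simpa using mul_mem_baseEigenvalues hu hv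

theorem image_val_setOf_mem {S : Set ℂ} (hS : ∀ a ∈ S, ‖a‖ = 1) :
    (fun u : ℂˣ => (u : ℂ)) '' {u : ℂˣ | (u : ℂ) ∈ S} = S := by
  refine Set.Subset.antisymm (Set.image_subset_iff.mpr fun u hu => hu) fun a ha => ?_
  have h0 : a ≠ 0 := fun h => by simpa [h] using hS a ha
  exact ⟨Units.mk0 a h0, ha, rfl⟩

/-- Representatives of distinct classes are pairwise inequivalent modulo `Λ_θ`. Bounding every
finite subset yields finiteness of the quotient as well as the bound on its order. -/
theorem card_finset_quotient_le [IsFiniteMeasure μ] [NeZero μ] (hΦ : Φ.IsIrreducible)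
    (hd : 0 < d) (hρ : Φ.IsEigenmatrix 1 ρ) (hpos : ∀ᵐ ω ∂μ, (ρ ω).PosDef)
    (s : Finset (peripheralSubgroup hΦ hd hρ hpos ⧸
      Φ.baseSubgroup.subgroupOf (peripheralSubgroup hΦ hd hρ hpos))) : s.card ≤ d ^ 2 := by
  rw [← Fintype.card_coe]
  refine card_le_of_pairwise_notMem_baseEigenvalues hρ hpos hΦ hd
    (fun q : s => ((Quotient.out q.1 : peripheralSubgroup hΦ hd hρ hpos) : ℂˣ))
    (fun q => (Quotient.out q.1).2) fun q r hqr h => hqr (Subtype.ext ?_)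
  have h1 : (Quotient.out q.1)⁻¹ * Quotient.out r.1 ∈
      Φ.baseSubgroup.subgroupOf (peripheralSubgroup hΦ hd hρ hpos) := by
    rw [Subgroup.mem_subgroupOf]
    have h2 := inv_mem_baseEigenvalues h
    rw [inv_inv, star_eq_inv_of_norm_eq_one (Quotient.out q.1).2.1] at h2
    change (((((Quotient.out q.1)⁻¹ * Quotient.out r.1 :
      peripheralSubgroup hΦ hd hρ hpos) : ℂˣ)) : ℂ) ∈ Φ.baseEigenvalues
    simpa using h2
  have h3 := QuotientGroup.eq.mpr h1
  rwa [QuotientGroup.out_eq', QuotientGroup.out_eq'] at h3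

end ErgodicQuantumProcess

end Eigenvalues

theorem theorem1 {Ω : Type*} [MeasurableSpace Ω] (μ : Measure Ω) [IsProbabilityMeasure μ]
    (d : ℕ) (hd : 0 < d) (Φ : ErgodicQuantumProcess μ d) (hΦ : Φ.IsIrreducible) :
    -- `Λ_θ ⊆ Λ_Φ` are groups under multiplication, and the quotient is finite of order `≤ d ^ 2`
    (∃ G H : Subgroup ℂˣ,
      (fun u : ℂˣ => (u : ℂ)) '' (G : Set ℂˣ) = Φ.peripheralEigenvalues ∧
      (fun u : ℂˣ => (u : ℂ)) '' (H : Set ℂˣ) = Φ.baseEigenvalues ∧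
      H ≤ G ∧
      Finite (G ⧸ H.subgroupOf G) ∧
      Nat.card (G ⧸ H.subgroupOf G) ≤ d ^ 2) ∧
    -- every peripheral eigenvalue is simple and has order at most `d` modulo `Λ_θ`
    ∀ α ∈ Φ.peripheralEigenvalues,
      Module.finrank ℂ (Φ.eigenspace α) = 1 ∧ Φ.orderModBase α ≤ d := by
  obtain ⟨ρ, hρ, hpos⟩ := ErgodicQuantumProcess.exists_isEigenmatrix_one_posDef hΦ hd
  have hcard := ErgodicQuantumProcess.card_finset_quotient_le hΦ hd hρ hpos
  have hfin : Finite (ErgodicQuantumProcess.peripheralSubgroup hΦ hd hρ hpos ⧸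
      Φ.baseSubgroup.subgroupOf (ErgodicQuantumProcess.peripheralSubgroup hΦ hd hρ hpos)) := by
    by_contra hinf
    rw [not_finite_iff_infinite] at hinf
    obtain ⟨s, hs⟩ := Infinite.exists_subset_card_eq
      (ErgodicQuantumProcess.peripheralSubgroup hΦ hd hρ hpos ⧸
        Φ.baseSubgroup.subgroupOf (ErgodicQuantumProcess.peripheralSubgroup hΦ hd hρ hpos))
      (d ^ 2 + 1)
    have := hcard s
    omega
  refine ⟨⟨ErgodicQuantumProcess.peripheralSubgroup hΦ hd hρ hpos, Φ.baseSubgroup,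
    ErgodicQuantumProcess.image_val_setOf_mem (S := Φ.peripheralEigenvalues) fun a ha => ha.1,
    ErgodicQuantumProcess.image_val_setOf_mem (S := Φ.baseEigenvalues) fun a =>
      ErgodicQuantumProcess.norm_eq_one_of_mem_baseEigenvalues,
    fun u hu =>
      ErgodicQuantumProcess.mem_peripheralEigenvalues_of_mem_baseEigenvalues hd hρ hpos hu, hfin, ?_⟩,
    fun α hα => ⟨ErgodicQuantumProcess.finrank_eigenspace_eq_one hΦ hd hρ hpos hα, ?_⟩⟩
  · have := Fintype.ofFinite (ErgodicQuantumProcess.peripheralSubgroup hΦ hd hρ hpos ⧸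
      Φ.baseSubgroup.subgroupOf (ErgodicQuantumProcess.peripheralSubgroup hΦ hd hρ hpos))
    rw [Nat.card_eq_fintype_card, ← Finset.card_univ]
    exact hcard _
  · obtain ⟨n, hn0, hnd, hn⟩ :=
      ErgodicQuantumProcess.exists_pow_mem_baseEigenvalues hρ hpos hΦ hd hα
    have h : Φ.orderModBase α ≤ n := sInf_le ⟨n, hn0, hn, rfl⟩
    exact h.trans (by exact_mod_cast hnd)
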